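/- Let $\alpha>0$, $0\le\beta<2$, $\sigma>0$ and $C>0$, and let $$S_\beta=\{x e^{\pm i\theta\pi/2}:\ x\in[0,1],\ \theta\in[0,\beta]\}.$$ Let either $l=0$ and $m=\lfloor\alpha\rfloor$ (the integral in the representation of $z^\alpha$), or $l\in\{0,1\}$ and $m=\lceil\alpha\rceil$ (the two integrals in the representation of $z^\alpha\log z$). Put $\delta=1$, $\omega=\tfrac12$ if $\beta\neq0$ and $\delta=\omega=\sqrt2$ if $\beta=0$, and let $$s_k=\delta+\omega\Big(1+\cos\frac{(2m-2k+1)\pi}{2m}\Big),\qquad k=1,\dots,m .$$ For an integer $N_1\ge1$ put $$h=\sigma^2\alpha^2,\qquad T=\sigma\alpha\sqrt{N_1}=\sqrt{N_1h},\qquad \kappa=\frac{\alpha}{m+1-\alpha},\qquad N_t=\lceil(\kappa+1)^2N_1\rceil,$$ and for $u>0$ $$f^{(l)}(u,z)=\frac{1}{2\sqrt u}\,\frac{zC^\alpha(\sqrt u-T)^l e^{\sqrt u-T}}{Ce^{\frac1\alpha(\sqrt u-T)}+z}\prod_{k=1}^m\frac{z-s_k}{Ce^{\frac1\alpha(\sqrt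 u-T)}+s_k}.$$ For every $z\in S_\beta$ the function $f^{(l)}(\cdot,z)$ is integrable on $[0,N_th]$. Let $$E_Q^{(l)}(z)=\int_0^{N_th}f^{(l)}(u,z)\,du-h\sum_{j=1}^{N_t}f^{(l)}(jh,z)$$ be the error of the composite rectangle rule with step $h$. Let $\sigma_{\rm opt}=\pi\sqrt{2(2-\beta)}/\sqrt\alpha$ and $\eta=\sigma_{\rm opt}/\sigma$. Then there is a constant $K>0$, depending only on $\alpha,\beta,\sigma,C,l,m$, such that for all integers $N_1\ge1$ and all $z\in S_\beta$ $$|E_Q^{(l)}(z)|\le\begin{cases}K\,T^l e^{-T}=K\,T^l e^{-\pi\eta^{-1}\sqrt{2(2-\beta)N_1\alpha}},&\sigma\le\sigma_{\rm opt},\\[2pt] K\,e^{-\pi\eta\sqrt{2(2-\beta)N_1\alpha}},&\sigma>\sigma_{\rm opt}.\end{cases}$$ -/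

import Mathlib

namespace Tapered

noncomputable section

/-- The closed sector `S_β`: all `x e^{± i θ π / 2}` with `x ∈ [0,1]` and `θ ∈ [0,β]`. -/
def sector (β : ℝ) : Set ℂ :=
  {z | ∃ x ∈ Set.Icc (0 : ℝ) 1, ∃ θ ∈ Set.Icc (0 : ℝ) β,
    z = (x : ℂ) * Complex.exp (((θ * Real.pi / 2 : ℝ) : ℂ) * Complex.I) ∨
    z = (x : ℂ) * Complex.exp (-(((θ * Real.pi / 2 : ℝ) : ℂ) * Complex.I))}

/-- Left end point `δ` of the node interval `[δ, δ + 2ω]`. -/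
def nodeDelta (β : ℝ) : ℝ := if β = 0 then Real.sqrt 2 else 1

/-- Half length `ω` of the node interval `[δ, δ + 2ω]`. -/
def nodeOmega (β : ℝ) : ℝ := if β = 0 then Real.sqrt 2 else 1 / 2

/-- The shifted Chebyshev nodes `s_k`, `1 ≤ k ≤ m`: the roots of `T_m((s - δ)/ω - 1)`. -/
def node (β : ℝ) (m k : ℕ) : ℝ :=
  nodeDelta β + nodeOmega β *
    (1 + Real.cos ((2 * (m : ℝ) - 2 * (k : ℝ) + 1) * Real.pi / (2 * (m : ℝ))))

/-- The step length `h = σ² α²`. -/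
def step (α σ : ℝ) : ℝ := σ ^ 2 * α ^ 2

/-- The truncation parameter `T = σ α √N₁`. -/
def trunc (α σ : ℝ) (N₁ : ℕ) : ℝ := σ * α * Real.sqrt N₁

/-- `κ = α / (m + 1 - α)`. -/
def kappa (α : ℝ) (m : ℕ) : ℝ := α / ((m : ℝ) + 1 - α)

/-- The number of quadrature points `N_t = ⌈(κ + 1)² N₁⌉`. -/
def numPoints (α : ℝ) (m N₁ : ℕ) : ℕ := ⌈(kappa α m + 1) ^ 2 * (N₁ : ℝ)⌉₊

/-- The integrand `f^{(l)}(u, z)` after the substitution `t + T = √u`. -/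
def integrand (α β C T : ℝ) (m l : ℕ) (u : ℝ) (z : ℂ) : ℂ :=
  (1 / (2 * (Real.sqrt u : ℂ))) *
    (z * ((C ^ α * (Real.sqrt u - T) ^ l * Real.exp (Real.sqrt u - T) : ℝ) : ℂ) /
      (((C * Real.exp (1 / α * (Real.sqrt u - T)) : ℝ) : ℂ) + z)) *
    ∏ k ∈ Finset.Icc 1 m,
      (z - (node β m k : ℂ)) /
        ((C * Real.exp (1 / α * (Real.sqrt u - T)) + node β m k : ℝ) : ℂ)

/-- The error `E_Q^{(l)}(z)` of the rectangle rule with step `h` and points `h, 2h, …, N_t h`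
for the integral of `f^{(l)}(·, z)` over `[0, N_t h]`. -/
def quadError (α β σ C : ℝ) (m l N₁ : ℕ) (z : ℂ) : ℂ :=
  (∫ u in (0 : ℝ)..(numPoints α m N₁ : ℝ) * step α σ,
      integrand α β C (trunc α σ N₁) m l u z) -
    (step α σ : ℂ) * ∑ j ∈ Finset.Icc 1 (numPoints α m N₁),
      integrand α β C (trunc α σ N₁) m l ((j : ℝ) * step α σ) z

/-- `σ_opt = π √(2(2-β)) / √α`. -/
def sigmaOpt (α β : ℝ) : ℝ := Real.pi * Real.sqrt (2 * (2 - β)) / Real.sqrt α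

/-- `η = σ_opt / σ`. -/
def eta (α β σ : ℝ) : ℝ := sigmaOpt α β / σ

end

end Tapered

/-!
The substitution `u = w²` turns the integral into `∫ G(w) dw` along the real axis, where `G` is
meromorphic with `X(w) = C exp ((w - T) / α)` in its denominators (`integrandSqrt`, `expScale`). The
kernel `1 / (1 - exp (-2 π i w² / h))` has its poles at the square roots `√(j h)` of the quadrature
points, where the residue of kernel times `G` is `h G(√(j h)) / (4 π i √(j h))`. Hence the
residue theorem for a rectangle `[r, R] × [-b, b]`, corrected by the residue theorem for `G` alone
on the lower half of it, expresses the error of the rectangle rule by the residues at the poles of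
`G` and by integrals over the six parts of the boundary off the real axis (`quadrature_identity`).
In these terms the kernel, or the kernel minus `1` in the lower half plane, has size
`exp (-4 π Re w |Im w| / h)` away from the real axis.

The height is `b = 2 π α`. There `X` is positive, so `G` obeys the same bounds as on the real axis,
while all poles of `G` in the rectangle, the solutions of `X(w) = -y` with `y = z` or `y` a node,
keep at a fixed distance from the horizontal sides. The poles satisfy `|Im w| ≥ α π (2 - β) / 2`, so
the kernel contributes at most `exp (-η² Re w)` there up to a constant, because
`4 π α π (2 - β) / (2 h) = η²`. The residues of `G` are at most a constant times
`|w - T|^l exp (Re w - T)`, uniformly in `z`: for the pole of `z` every factor of the product becomes `-1`, for a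
node the factor `z - s k` cancels (`exists_residue_left`, `exists_residue_node`). So a pole
contributes `|w - T|^l exp (Re w - T - η² Re w)` with `0 < Re w ≤ T + O(1)`, which is largest near
`Re w = 0` if `η ≥ 1`, with the value `T^l exp (-T)`, and near `Re w = T` if `η < 1`, with the
value `exp (-η² T)`.

The vertical sides must avoid the poles uniformly in `z`. On the right `X` is large. On the left
there are two candidates, `r² = h / 3` and `r² = 2 h / 3`; the values of `|X|` on them differ by a
fixed factor, so on one of them `|X|` is separated from `|z|` by a fixed factor. As `r² / h` and
`R² / h` stay away from the integers, the kernel is bounded on both sides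
(`exists_norm_kernel_le`). There `G` is `O(T^l exp (-T))`, as it is on the two short pieces of the
real axis that the rectangle omits. For the finitely many small `N₁` a crude bound suffices.
-/

namespace Tapered

open Complex Set Filter Topology MeasureTheory

/-! ### The residue theorem for a rectangle -/

/-- The contour integral of `F` along the positively oriented boundary of the rectangle
`[a, b] × [c, d]`. -/
noncomputable def rectInt (F : ℂ → ℂ) (a b c d : ℝ) : ℂ :=
  (∫ x : ℝ in a..b, F (x + c * I)) - (∫ x : ℝ in a..b, F (x + d * I)) +
    I * (∫ y : ℝ in c..d, F (b + y * I)) - I * (∫ y : ℝ in c..d, F (a + y * I))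

lemma rectInt_eq_zero {F : ℂ → ℂ} {a b c d : ℝ} (hab : a ≤ b) (hcd : c ≤ d)
    (hF : ∀ w : ℂ, w.re ∈ Icc a b → w.im ∈ Icc c d → DifferentiableAt ℂ F w) :
    rectInt F a b c d = 0 := by
  have h := integral_boundary_rect_eq_zero_of_differentiableOn F (⟨a, c⟩ : ℂ) ⟨b, d⟩ (by
    intro w hw
    simp only [uIcc_of_le hab, uIcc_of_le hcd, mem_reProdIm] at hw
    exact (hF w hw.1 hw.2).differentiableWithinAt)
  simpa [rectInt, smul_eq_mul] using h

lemma rectInt_congr {F G : ℂ → ℂ} {a b c d : ℝ} (hab : a ≤ b) (hcd : c ≤ d)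
    (h : ∀ w : ℂ, w.re ∈ Icc a b → w.im ∈ Icc c d →
      (w.re = a ∨ w.re = b ∨ w.im = c ∨ w.im = d) → F w = G w) :
    rectInt F a b c d = rectInt G a b c d := by
  unfold rectInt
  congr 1
  · congr 1
    · congr 1 <;> refine intervalIntegral.integral_congr fun x hx => h _ ?_ ?_ ?_ <;>
        simp_all
    · congr 1
      refine intervalIntegral.integral_congr fun x hx => h _ ?_ ?_ ?_ <;>
        simp_all
  · congr 1
    refine intervalIntegral.integral_congr fun x hx => h _ ?_ ?_ ?_ <;>
        simp_all

lemma rectInt_add {F G : ℂ → ℂ} {a b c d : ℝ} (hab : a ≤ b) (hcd : c ≤ d)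
    (hF : ∀ w : ℂ, w.re ∈ Icc a b → w.im ∈ Icc c d →
      (w.re = a ∨ w.re = b ∨ w.im = c ∨ w.im = d) → ContinuousAt F w)
    (hG : ∀ w : ℂ, w.re ∈ Icc a b → w.im ∈ Icc c d →
      (w.re = a ∨ w.re = b ∨ w.im = c ∨ w.im = d) → ContinuousAt G w) :
    rectInt (fun w => F w + G w) a b c d = rectInt F a b c d + rectInt G a b c d := by
  have key : ∀ H : ℂ → ℂ, (∀ w : ℂ, w.re ∈ Icc a b → w.im ∈ Icc c d →
      (w.re = a ∨ w.re = b ∨ w.im = c ∨ w.im = d) → ContinuousAt H w) →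
      IntervalIntegrable (fun x : ℝ => H (x + c * I)) volume a b ∧
      IntervalIntegrable (fun x : ℝ => H (x + d * I)) volume a b ∧
      IntervalIntegrable (fun y : ℝ => H (b + y * I)) volume c d ∧
      IntervalIntegrable (fun y : ℝ => H (a + y * I)) volume c d := by
    intro H hH
    refine ⟨?_, ?_, ?_, ?_⟩
    all_goals
      apply ContinuousOn.intervalIntegrable
      intro x hx
      refine (ContinuousAt.comp_continuousWithinAt (g := H) (hH _ ?_ ?_ ?_)
        (by fun_prop)) <;> simp_all
  obtain ⟨f1, f2, f3, f4⟩ := key F hF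
  obtain ⟨g1, g2, g3, g4⟩ := key G hG
  unfold rectInt
  rw [intervalIntegral.integral_add f1 g1, intervalIntegral.integral_add f2 g2,
    intervalIntegral.integral_add f3 g3, intervalIntegral.integral_add f4 g4]
  ring

lemma rectInt_const_mul (k : ℂ) (F : ℂ → ℂ) (a b c d : ℝ) :
    rectInt (fun w => k * F w) a b c d = k * rectInt F a b c d := by
  simp only [rectInt, intervalIntegral.integral_const_mul]
  ring

lemma rectInt_inv_sub {p : ℂ} {a b c d : ℝ} (ha : a < p.re) (hb : p.re < b) (hc : c < p.im)
    (hd : p.im < d) : rectInt (fun w => (w - p)⁻¹) a b c d = 2 * Real.pi * I := by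
  have hor : ∀ e : ℝ, e ≠ p.im → ∫ x : ℝ in a..b, ((x : ℂ) + e * I - p)⁻¹ =
      Complex.log (b + e * I - p) - Complex.log (a + e * I - p) := by
    intro e he
    have hs : ∀ x : ℝ, ((x : ℂ) + e * I - p) ∈ slitPlane := fun x =>
      mem_slitPlane_iff.2 (Or.inr (by simpa [sub_eq_zero] using he))
    have hd : ∀ x : ℝ, HasDerivAt (fun x : ℝ => Complex.log ((x : ℂ) + e * I - p))
        ((x : ℂ) + e * I - p)⁻¹ x := by
      intro x
      have := ((((hasDerivAt_id (x : ℂ)).add_const (e * I)).sub_const p).clog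
        (hs x)).comp_ofReal
      simpa using this
    refine intervalIntegral.integral_eq_sub_of_hasDerivAt (fun x _ => hd x) ?_
    apply Continuous.intervalIntegrable
    exact Continuous.inv₀ (by fun_prop) fun x => slitPlane_ne_zero (hs x)
  have hR : I * ∫ y : ℝ in c..d, ((b : ℂ) + y * I - p)⁻¹ =
      Complex.log (b + d * I - p) - Complex.log (b + c * I - p) := by
    have hs : ∀ y : ℝ, ((b : ℂ) + y * I - p) ∈ slitPlane := fun y =>
      mem_slitPlane_iff.2 (Or.inl (by simpa using hb))
    have hd : ∀ y : ℝ, HasDerivAt (fun y : ℝ => Complex.log ((b : ℂ) + y * I - p))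
        (I * ((b : ℂ) + y * I - p)⁻¹) y := by
      intro y
      have := (((((hasDerivAt_id (y : ℂ)).mul_const I).const_add (b : ℂ)).sub_const p).clog
        (hs y)).comp_ofReal
      simpa [div_eq_mul_inv] using this
    rw [← intervalIntegral.integral_const_mul]
    refine intervalIntegral.integral_eq_sub_of_hasDerivAt (fun x _ => hd x) ?_
    apply Continuous.intervalIntegrable
    exact continuous_const.mul
      (Continuous.inv₀ (by fun_prop) fun x => slitPlane_ne_zero (hs x))
  -- the left side crosses the branch cut of `log (w - p)`, so `log (p - w)` is used there
  have hL : I * ∫ y : ℝ in c..d, ((a : ℂ) + y * I - p)⁻¹ =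
      Complex.log (-(a + d * I - p)) - Complex.log (-(a + c * I - p)) := by
    have hs : ∀ y : ℝ, -((a : ℂ) + y * I - p) ∈ slitPlane := fun y =>
      mem_slitPlane_iff.2 (Or.inl (by simpa using ha))
    have hd : ∀ y : ℝ, HasDerivAt (fun y : ℝ => Complex.log (-((a : ℂ) + y * I - p)))
        (I * ((a : ℂ) + y * I - p)⁻¹) y := by
      intro y
      have := (((((hasDerivAt_id (y : ℂ)).mul_const I).const_add (a : ℂ)).sub_const p).neg.clog
        (hs y)).comp_ofReal
      convert this using 1
      · simp only [Pi.neg_apply, id]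
      · rw [Pi.neg_apply, neg_div_neg_eq, one_mul, div_eq_mul_inv]; rfl
    rw [← intervalIntegral.integral_const_mul]
    refine intervalIntegral.integral_eq_sub_of_hasDerivAt (fun x _ => hd x) ?_
    apply Continuous.intervalIntegrable
    refine continuous_const.mul (Continuous.inv₀ (by fun_prop) fun x => ?_)
    have := slitPlane_ne_zero (hs x)
    exact neg_ne_zero.1 this
  have hpos : Complex.log (a + d * I - p) - Complex.log (-(a + d * I - p)) = Real.pi * I := by
    simp only [Complex.log, norm_neg]
    rw [arg_neg_eq_arg_sub_pi_of_im_pos (by simpa using hd)]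
    push_cast; ring
  have hneg : Complex.log (a + c * I - p) - Complex.log (-(a + c * I - p)) = -(Real.pi * I) := by
    simp only [Complex.log, norm_neg]
    rw [arg_neg_eq_arg_add_pi_of_im_neg (by simpa using hc)]
    push_cast; ring
  unfold rectInt
  rw [hor c hc.ne, hor d hd.ne', hR, hL]
  linear_combination hpos - hneg

/-- Removal of finitely many singularities at which `F w = o(1 / (w - p))`. -/
lemma rectInt_eq_zero_of_isLittleO {F : ℂ → ℂ} {a b c d : ℝ} (hab : a ≤ b) (hcd : c ≤ d)
    (S : Finset ℂ) (hS : ∀ p ∈ S, p.re ∈ Ioo a b ∧ p.im ∈ Ioo c d)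
    (hF : ∀ w : ℂ, w.re ∈ Icc a b → w.im ∈ Icc c d → w ∉ S → DifferentiableAt ℂ F w)
    (ho : ∀ p ∈ S, Tendsto (fun w => (w - p) * F w) (𝓝[≠] p) (𝓝 0)) :
    rectInt F a b c d = 0 := by
  classical
  let H : ℂ → ℂ := fun w => if w ∈ S then limUnder (𝓝[≠] w) F else F w
  have hH : rectInt F a b c d = rectInt H a b c d := by
    refine rectInt_congr hab hcd fun w _ _ hw => ?_
    have : w ∉ S := fun hwS => by
      obtain ⟨⟨h1, h2⟩, h3, h4⟩ := hS w hwS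
      rcases hw with h | h | h | h <;> linarith
    simp [H, this]
  rw [hH]
  refine rectInt_eq_zero hab hcd fun w hre him => ?_
  by_cases hw : w ∈ S
  · -- near `w` the function `H` is the update of `F` at `w` by its limit
    have hopen : ∀ᶠ v in 𝓝 w, v.re ∈ Ioo a b ∧ v.im ∈ Ioo c d :=
      (continuous_re.continuousAt.eventually_mem (isOpen_Ioo.mem_nhds (hS w hw).1)).and
        (continuous_im.continuousAt.eventually_mem (isOpen_Ioo.mem_nhds (hS w hw).2))
    have hfin : ∀ᶠ v in 𝓝 w, v ∉ S.erase w :=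
      (S.erase w).finite_toSet.isClosed.isOpen_compl.mem_nhds (by simp)
    have hs := hopen.and hfin
    set s : Set ℂ := {v | (v.re ∈ Ioo a b ∧ v.im ∈ Ioo c d) ∧ v ∉ S.erase w} with hsdef
    have hs' : s ∈ 𝓝 w := hs
    have hdiff : DifferentiableOn ℂ F (s \ {w}) := by
      intro v hv
      have hvS : v ∉ S := fun h => hv.1.2 (Finset.mem_erase.2 ⟨hv.2, h⟩)
      exact (hF v (Ioo_subset_Icc_self hv.1.1.1) (Ioo_subset_Icc_self hv.1.1.2)
        hvS).differentiableWithinAt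
    have hlo : (fun v => F v - F w) =o[𝓝[≠] w] fun v => (v - w)⁻¹ := by
      rw [Asymptotics.isLittleO_iff_tendsto']
      · have h1 : Tendsto (fun v => (v - w) * F v - (v - w) * F w) (𝓝[≠] w) (𝓝 (0 - 0)) := by
          refine (ho w hw).sub (tendsto_nhdsWithin_of_tendsto_nhds ?_)
          have : Continuous fun v => (v - w) * F w := by fun_prop
          simpa using this.tendsto w
        rw [sub_zero] at h1
        refine h1.congr fun v => ?_
        rw [div_inv_eq_mul]; ring
      · filter_upwards [self_mem_nhdsWithin] with v hv h0
        exact absurd (inv_eq_zero.1 h0) (sub_ne_zero.2 hv)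
    have hup := (differentiableOn_update_limUnder_of_isLittleO hs' hdiff hlo).differentiableAt hs'
    refine hup.congr_of_eventuallyEq ?_
    filter_upwards [hfin] with v hv
    by_cases hvw : v = w
    · subst hvw; simp [H, hw]
    · have : v ∉ S := fun h => hv (Finset.mem_erase.2 ⟨hvw, h⟩)
      simp [H, this, hvw]
  · refine (hF w hre him hw).congr_of_eventuallyEq ?_
    filter_upwards [S.finite_toSet.isClosed.isOpen_compl.mem_nhds (by simpa using hw)] with v hv
    have : v ∉ S := hv
    simp [H, this]

lemma rectInt_sum_simple {a b c d : ℝ} (hab : a ≤ b) (hcd : c ≤ d)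
    (S : Finset ℂ) (hS : ∀ p ∈ S, p.re ∈ Ioo a b ∧ p.im ∈ Ioo c d) (r : ℂ → ℂ) :
    rectInt (fun w => ∑ p ∈ S, r p * (w - p)⁻¹) a b c d = 2 * Real.pi * I * ∑ p ∈ S, r p := by
  classical
  induction S using Finset.induction_on with
  | empty => simp [rectInt]
  | insert q S hq ih =>
    have hne : ∀ p ∈ insert q S, ∀ w : ℂ,
        (w.re = a ∨ w.re = b ∨ w.im = c ∨ w.im = d) → w - p ≠ 0 := by
      intro p hp w hw h0
      obtain ⟨⟨h1, h2⟩, h3, h4⟩ := hS p hp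
      have : w = p := sub_eq_zero.1 h0
      subst this
      rcases hw with h | h | h | h <;> linarith
    have hcont : ∀ p ∈ insert q S, ∀ w : ℂ,
        (w.re = a ∨ w.re = b ∨ w.im = c ∨ w.im = d) →
        ContinuousAt (fun w => r p * (w - p)⁻¹) w := fun p hp w hw =>
      continuousAt_const.mul (ContinuousAt.inv₀ (by fun_prop) (hne p hp w hw))
    simp only [Finset.sum_insert hq]
    have hqS := hS q (Finset.mem_insert_self q S)
    rw [rectInt_add hab hcd (fun w _ _ hw => hcont q (Finset.mem_insert_self q S) w hw)
      (fun w _ _ hw => tendsto_finsetSum _ fun p hp =>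
        hcont p (Finset.mem_insert_of_mem hp) w hw),
      ih (fun p hp => hS p (Finset.mem_insert_of_mem hp)), rectInt_const_mul,
      rectInt_inv_sub hqS.1.1 hqS.1.2 hqS.2.1 hqS.2.2]
    ring

/-- The residue theorem for a rectangle and a function with finitely many simple poles. -/
theorem rectInt_eq_sum_residues {F : ℂ → ℂ} {a b c d : ℝ} (hab : a ≤ b) (hcd : c ≤ d)
    (S : Finset ℂ) (hS : ∀ p ∈ S, p.re ∈ Ioo a b ∧ p.im ∈ Ioo c d)
    (hF : ∀ w : ℂ, w.re ∈ Icc a b → w.im ∈ Icc c d → w ∉ S → DifferentiableAt ℂ F w)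
    (r : ℂ → ℂ) (hr : ∀ p ∈ S, Tendsto (fun w => (w - p) * F w) (𝓝[≠] p) (𝓝 (r p))) :
    rectInt F a b c d = 2 * Real.pi * I * ∑ p ∈ S, r p := by
  classical
  set Q : ℂ → ℂ := fun w => ∑ p ∈ S, r p * (w - p)⁻¹ with hQ
  have hQd : ∀ w, w ∉ S → DifferentiableAt ℂ Q w := by
    intro w hw
    refine DifferentiableAt.fun_sum fun p hp => ?_
    have : w - p ≠ 0 := sub_ne_zero.2 fun h => hw (h ▸ hp)
    fun_prop (disch := assumption)
  have hbd : ∀ w : ℂ, (w.re = a ∨ w.re = b ∨ w.im = c ∨ w.im = d) → w ∉ S := by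
    intro w hw hwS
    obtain ⟨⟨h1, h2⟩, h3, h4⟩ := hS w hwS
    rcases hw with h | h | h | h <;> linarith
  have h0 : rectInt (fun w => F w - Q w) a b c d = 0 := by
    refine rectInt_eq_zero_of_isLittleO hab hcd S hS
      (fun w h1 h2 h3 => (hF w h1 h2 h3).sub (hQd w h3)) fun q hq => ?_
    have hQq : Tendsto (fun w => (w - q) * Q w) (𝓝[≠] q) (𝓝 (r q)) := by
      have h1 : Tendsto (fun w => r q + (w - q) * ∑ p ∈ S.erase q, r p * (w - p)⁻¹)
          (𝓝[≠] q) (𝓝 (r q + 0 * ∑ p ∈ S.erase q, r p * (q - p)⁻¹)) := by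
        refine tendsto_nhdsWithin_of_tendsto_nhds (tendsto_const_nhds.add (Tendsto.mul ?_ ?_))
        · have : Continuous fun w : ℂ => w - q := by fun_prop
          simpa using this.tendsto q
        · refine tendsto_finsetSum _ fun p hp => tendsto_const_nhds.mul (Tendsto.inv₀ ?_ ?_)
          · exact (continuous_id.sub continuous_const).tendsto q
          · exact sub_ne_zero.2 (Finset.ne_of_mem_erase hp).symm
      rw [zero_mul, add_zero] at h1
      refine h1.congr' ?_
      filter_upwards [self_mem_nhdsWithin] with w hw
      have hwq : w - q ≠ 0 := sub_ne_zero.2 hw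
      rw [hQ]
      simp only
      rw [← Finset.add_sum_erase S _ hq]
      field_simp
    have := (hr q hq).sub hQq
    rw [sub_self] at this
    exact this.congr fun w => by ring
  have hadd := rectInt_add (F := fun w => F w - Q w) (G := Q) hab hcd
    (fun w h1 h2 h3 => ((hF w h1 h2 (hbd w h3)).sub (hQd w (hbd w h3))).continuousAt)
    (fun w h1 h2 h3 => (hQd w (hbd w h3)).continuousAt)
  simp only [sub_add_cancel] at hadd
  rw [h0, zero_add] at hadd
  rw [← rectInt_sum_simple hab hcd S hS r]
  exact hadd

/-! ### The error of the rectangle rule as a contour integral -/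

lemma tendsto_sub_mul_inv_of_hasDerivAt {f : ℂ → ℂ} {f' p : ℂ} (hf : HasDerivAt f f' p)
    (h0 : f p = 0) (hf' : f' ≠ 0) :
    Tendsto (fun w => (w - p) * (f w)⁻¹) (𝓝[≠] p) (𝓝 f'⁻¹) := by
  have h1 := (hasDerivAt_iff_tendsto_slope.1 hf).inv₀ hf'
  refine h1.congr fun w => ?_
  rw [slope_def_field, h0, sub_zero, inv_div, div_eq_mul_inv]

/-- The kernel `1 / (1 - exp (-2 π i w² / h))`, which has simple poles at the points `√(j h)`
and tends to `0` in the first and to `1` in the fourth quadrant. -/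
noncomputable def kernel (h : ℝ) (w : ℂ) : ℂ := (1 - exp (-(2 * Real.pi * I * w ^ 2 / h)))⁻¹

lemma exp_kernel_eq_one {h : ℝ} (hh : 0 < h) {w : ℂ} (hw : 0 < w.re)
    (h1 : exp (-(2 * Real.pi * I * w ^ 2 / h)) = 1) :
    w.im = 0 ∧ ∃ j : ℕ, w.re ^ 2 = j * h := by
  obtain ⟨n, hn⟩ := Complex.exp_eq_one_iff.1 h1
  have hhc : (h : ℂ) ≠ 0 := by exact_mod_cast hh.ne'
  have hpi : (2 * Real.pi * I : ℂ) ≠ 0 := Complex.two_pi_I_ne_zero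
  have h2 : w ^ 2 = ((-n * h : ℝ) : ℂ) := by
    have : (2 * Real.pi * I : ℂ) * w ^ 2 = (2 * Real.pi * I) * (-n * h) := by
      field_simp at hn
      linear_combination (-2 * Real.pi * I : ℂ) * hn
    have := mul_left_cancel₀ hpi this
    rw [this]; push_cast; ring
  have him : w.im = 0 := by
    have := congrArg Complex.im h2
    simp only [sq, mul_im, ofReal_im] at this
    have h3 : w.re * w.im = 0 := by linarith
    exact (mul_eq_zero.1 h3).resolve_left hw.ne'
  have hre : w.re ^ 2 = -n * h := by
    have := congrArg Complex.re h2
    simp only [sq, mul_re, ofReal_re, him] at this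
    linarith [sq w.re]
  refine ⟨him, ?_⟩
  have hn0 : (0 : ℝ) ≤ ((-n : ℤ) : ℝ) := by
    push_cast
    have : 0 < w.re ^ 2 := by positivity
    rw [hre] at this
    exact (pos_of_mul_pos_left this hh.le).le
  have hn1 : 0 ≤ -n := by exact_mod_cast hn0
  refine ⟨(-n).toNat, ?_⟩
  have : (((-n).toNat : ℤ) : ℝ) = ((-n : ℤ) : ℝ) := by rw [Int.toNat_of_nonneg hn1]
  rw [hre]
  have h5 : (((-n).toNat : ℕ) : ℝ) = (((-n).toNat : ℤ) : ℝ) := by norm_cast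
  rw [h5, this]; push_cast; ring

lemma differentiableAt_kernel {h : ℝ} {w : ℂ}
    (h1 : exp (-(2 * Real.pi * I * w ^ 2 / h)) ≠ 1) : DifferentiableAt ℂ (kernel h) w := by
  unfold kernel
  refine DifferentiableAt.fun_inv (by fun_prop) (sub_ne_zero.2 h1.symm)

lemma tendsto_kernel {h : ℝ} (hh : 0 < h) {j : ℕ} (hj : 1 ≤ j) :
    Tendsto (fun w => (w - (Real.sqrt (j * h) : ℂ)) * kernel h w) (𝓝[≠] (Real.sqrt (j * h) : ℂ))
      (𝓝 (h / (4 * Real.pi * I * Real.sqrt (j * h)))) := by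
  have hhc : (h : ℂ) ≠ 0 := by exact_mod_cast hh.ne'
  have hj0 : (0 : ℝ) < j := by exact_mod_cast hj
  have hs : ((Real.sqrt (j * h) : ℝ) : ℂ) ^ 2 = j * h := by
    rw [← ofReal_pow, Real.sq_sqrt (by positivity)]; push_cast; ring
  have hs0 : ((Real.sqrt (j * h) : ℝ) : ℂ) ≠ 0 := by
    exact_mod_cast (Real.sqrt_pos.2 (by positivity)).ne'
  have hE : exp (-(2 * Real.pi * I * ((Real.sqrt (j * h) : ℝ) : ℂ) ^ 2 / h)) = 1 := by
    rw [hs, Complex.exp_eq_one_iff]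
    refine ⟨-j, ?_⟩
    field_simp
    push_cast
    ring
  have hd : HasDerivAt (fun w : ℂ => 1 - exp (-(2 * Real.pi * I * w ^ 2 / h)))
      (4 * Real.pi * I * Real.sqrt (j * h) / h) (Real.sqrt (j * h) : ℂ) := by
    have h1 : HasDerivAt (fun w : ℂ => -(2 * Real.pi * I * w ^ 2 / h))
        (-(4 * Real.pi * I * Real.sqrt (j * h) / h)) (Real.sqrt (j * h) : ℂ) := by
      have := (((hasDerivAt_pow 2 (Real.sqrt (j * h) : ℂ)).const_mul
        (2 * Real.pi * I : ℂ)).div_const (h : ℂ)).neg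
      refine this.congr_deriv ?_
      push_cast
      ring
    have h2 := h1.cexp.const_sub 1
    rw [hE] at h2
    simpa using h2
  have := tendsto_sub_mul_inv_of_hasDerivAt hd (by rw [hE, sub_self])
    (by
      have := Real.pi_ne_zero
      have hpc : (Real.pi : ℂ) ≠ 0 := by exact_mod_cast this
      exact div_ne_zero (mul_ne_zero (mul_ne_zero (mul_ne_zero (by norm_num) hpc) I_ne_zero) hs0)
        hhc)
  rw [inv_div] at this
  exact this

/-- The quadrature error of the rectangle rule in the variable `u = w²`, written as a sum over
the poles of `G` plus contour integrals that do not meet the real axis except at the end points. -/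
theorem quadrature_identity {G : ℂ → ℂ} {h r R b : ℝ} {n : ℕ} (hh : 0 < h) (hr : 0 < r)
    (hrh : r ^ 2 < h) (hrR : r ≤ R) (hR : R ^ 2 = (n + 1 / 2) * h) (hb : 0 < b)
    (P : Finset ℂ) (hP : ∀ p ∈ P, p.re ∈ Ioo r R ∧ p.im ∈ Ioo (-b) b ∧ p.im ≠ 0)
    (hG : ∀ w : ℂ, w.re ∈ Icc r R → w.im ∈ Icc (-b) b → w ∉ P → DifferentiableAt ℂ G w)
    (c : ℂ → ℂ) (hc : ∀ p ∈ P, Tendsto (fun w => (w - p) * G w) (𝓝[≠] p) (𝓝 (c p))) :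
    (∫ x : ℝ in r..R, G x) -
        ∑ j ∈ Finset.Icc 1 n, h / (2 * (Real.sqrt (j * h) : ℂ)) * G (Real.sqrt (j * h)) =
      2 * Real.pi * I * ∑ p ∈ P, c p * (if 0 < p.im then kernel h p else kernel h p - 1)
      - (∫ x : ℝ in r..R, G (x + (-b : ℝ) * I) * (kernel h (x + (-b : ℝ) * I) - 1))
      + (∫ x : ℝ in r..R, G (x + b * I) * kernel h (x + b * I))
      - I * (∫ y : ℝ in (-b)..0, G (R + y * I) * (kernel h (R + y * I) - 1))
      - I * (∫ y : ℝ in (0 : ℝ)..b, G (R + y * I) * kernel h (R + y * I))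
      + I * (∫ y : ℝ in (-b)..0, G (r + y * I) * (kernel h (r + y * I) - 1))
      + I * (∫ y : ℝ in (0 : ℝ)..b, G (r + y * I) * kernel h (r + y * I)) := by
  classical
  have hbb : -b ≤ b := by linarith
  set W : Finset ℂ := (Finset.Icc 1 n).image fun j : ℕ => ((Real.sqrt (j * h) : ℝ) : ℂ) with hW
  have hinj : Set.InjOn (fun j : ℕ => ((Real.sqrt (j * h) : ℝ) : ℂ)) (Finset.Icc 1 n) := by
    intro i _ j _ hij
    have h1 : Real.sqrt (i * h) = Real.sqrt (j * h) := ofReal_injective hij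
    rw [Real.sqrt_inj (by positivity) (by positivity)] at h1
    exact_mod_cast mul_right_cancel₀ hh.ne' h1
  have hWmem : ∀ p ∈ W, ∃ j : ℕ, 1 ≤ j ∧ j ≤ n ∧ p = (Real.sqrt (j * h) : ℝ) := by
    intro p hp
    obtain ⟨j, hj, rfl⟩ := Finset.mem_image.1 hp
    rw [Finset.mem_Icc] at hj
    exact ⟨j, hj.1, hj.2, rfl⟩
  have hWP : Disjoint P W := by
    rw [Finset.disjoint_left]
    intro p hp hpW
    obtain ⟨j, -, -, rfl⟩ := hWmem p hpW
    exact (hP _ hp).2.2 (ofReal_im _)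
  have hWr : ∀ p ∈ W, p.re ∈ Ioo r R ∧ p.im ∈ Ioo (-b) b := by
    intro p hp
    obtain ⟨j, hj1, hjn, rfl⟩ := hWmem p hp
    have hj1' : (1 : ℝ) ≤ j := by exact_mod_cast hj1
    have hjn' : (j : ℝ) ≤ n := by exact_mod_cast hjn
    refine ⟨⟨?_, ?_⟩, ?_, ?_⟩
    · rw [ofReal_re]; exact Real.lt_sqrt_of_sq_lt (by nlinarith)
    · rw [ofReal_re, Real.sqrt_lt' (by linarith)]; nlinarith
    · simpa using hb
    · simpa using hb
  have hE : ∀ w : ℂ, w.re ∈ Icc r R → w.im ∈ Icc (-b) b → w ∉ W →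
      exp (-(2 * Real.pi * I * w ^ 2 / h)) ≠ 1 := by
    intro w hre him hw h1
    obtain ⟨h2, j, hj⟩ := exp_kernel_eq_one hh (hr.trans_le hre.1) h1
    refine hw (Finset.mem_image.2 ⟨j, Finset.mem_Icc.2 ⟨?_, ?_⟩, ?_⟩)
    · by_contra hlt
      have : j = 0 := by omega
      subst this
      have := hr.trans_le hre.1
      simp at hj
      linarith
    · by_contra hlt
      have h3 : (n : ℝ) + 1 ≤ j := by exact_mod_cast not_le.1 hlt
      have h4 : w.re ^ 2 ≤ R ^ 2 := pow_le_pow_left₀ (hr.le.trans hre.1) hre.2 2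
      nlinarith
    · rw [← hj, Real.sqrt_sq (hr.le.trans hre.1)]
      apply Complex.ext <;> simp [h2]
  have hK : ∀ w : ℂ, w.re ∈ Icc r R → w.im ∈ Icc (-b) b → w ∉ W →
      DifferentiableAt ℂ (kernel h) w := fun w h1 h2 h3 => differentiableAt_kernel (hE w h1 h2 h3)
  -- the full rectangle with the integrand `G * kernel`
  have hfull := rectInt_eq_sum_residues (F := fun w => G w * kernel h w) hrR hbb (P ∪ W)
    (fun p hp => by
      rcases Finset.mem_union.1 hp with hp | hp
      · exact ⟨(hP p hp).1, (hP p hp).2.1⟩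
      · exact hWr p hp)
    (fun w h1 h2 h3 => by
      rw [Finset.mem_union, not_or] at h3
      exact (hG w h1 h2 h3.1).mul (hK w h1 h2 h3.2))
    (fun p => if p ∈ P then c p * kernel h p else G p * (h / (4 * Real.pi * I * p)))
    (fun p hp => by
      by_cases hpP : p ∈ P
      · simp only [hpP, if_true]
        have h1 := hP p hpP
        have hpW : p ∉ W := Finset.disjoint_left.1 hWP hpP
        have h2 := (hK p (Ioo_subset_Icc_self h1.1) (Ioo_subset_Icc_self h1.2.1)
          hpW).continuousAt.tendsto
        refine ((hc p hpP).mul (h2.mono_left nhdsWithin_le_nhds)).congr fun w => by ring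
      · simp only [hpP, if_false]
        have hpW : p ∈ W := (Finset.mem_union.1 hp).resolve_left hpP
        have h1 := hWr p hpW
        have h2 := (hG p (Ioo_subset_Icc_self h1.1) (Ioo_subset_Icc_self h1.2)
          hpP).continuousAt.tendsto
        obtain ⟨j, hj1, hjn, rfl⟩ := hWmem p hpW
        refine ((h2.mono_left nhdsWithin_le_nhds).mul (tendsto_kernel hh hj1)).congr
          fun w => by ring)
  -- the lower half of the rectangle with the integrand `G`
  have hlow := rectInt_eq_sum_residues (F := G) (a := r) (b := R) (c := -b) (d := 0) hrR
    (by linarith) (P.filter fun p => p.im < 0)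
    (fun p hp => by
      rw [Finset.mem_filter] at hp
      exact ⟨(hP p hp.1).1, (hP p hp.1).2.1.1, hp.2⟩)
    (fun w h1 h2 h3 => by
      refine hG w h1 ⟨h2.1, h2.2.trans hb.le⟩ fun hw => h3 (Finset.mem_filter.2 ⟨hw, ?_⟩)
      exact lt_of_le_of_ne h2.2 (hP w hw).2.2)
    c (fun p hp => hc p (Finset.mem_filter.1 hp).1)
  rw [Finset.sum_union hWP, Finset.sum_congr rfl (fun p hp => if_pos hp),
    Finset.sum_congr rfl (fun p hp => if_neg (Finset.disjoint_right.1 hWP hp)),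
    hW, Finset.sum_image hinj] at hfull
  have hsum : 2 * Real.pi * I * ∑ p ∈ P, c p * kernel h p -
      2 * Real.pi * I * ∑ p ∈ P.filter (fun p => p.im < 0), c p =
      2 * Real.pi * I * ∑ p ∈ P, c p * (if 0 < p.im then kernel h p else kernel h p - 1) := by
    rw [Finset.sum_filter, ← mul_sub, ← Finset.sum_sub_distrib]
    congr 1
    refine Finset.sum_congr rfl fun p hp => ?_
    rcases lt_or_gt_of_ne (hP p hp).2.2 with h1 | h1
    · rw [if_pos h1, if_neg h1.not_gt]; ring
    · rw [if_neg h1.not_gt, if_pos h1]; ring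
  have hnodes : 2 * Real.pi * I * ∑ j ∈ Finset.Icc 1 n, G (Real.sqrt (j * h) : ℝ) *
        (h / (4 * Real.pi * I * (Real.sqrt (j * h) : ℝ))) =
      ∑ j ∈ Finset.Icc 1 n, h / (2 * (Real.sqrt (j * h) : ℂ)) * G (Real.sqrt (j * h)) := by
    rw [Finset.mul_sum]
    refine Finset.sum_congr rfl fun j hj => ?_
    have hj0 : (0 : ℝ) < j := by exact_mod_cast (Finset.mem_Icc.1 hj).1
    have hs0 : ((Real.sqrt (j * h) : ℝ) : ℂ) ≠ 0 := by
      exact_mod_cast (Real.sqrt_pos.2 (by positivity)).ne'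
    have hpc : (Real.pi : ℂ) ≠ 0 := by exact_mod_cast Real.pi_ne_zero
    field_simp
    ring
  have hbd : ∀ w : ℂ, w.re ∈ Icc r R → w.im ∈ Icc (-b) b →
      (w.re = r ∨ w.re = R ∨ w.im = -b ∨ w.im = b) → ContinuousAt G w ∧
        ContinuousAt (kernel h) w := by
    intro w h1 h2 h3
    refine ⟨(hG w h1 h2 fun hw => ?_).continuousAt, (hK w h1 h2 fun hw => ?_).continuousAt⟩
    · obtain ⟨⟨h4, h5⟩, ⟨h6, h7⟩, -⟩ := hP w hw
      rcases h3 with h | h | h | h <;> linarith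
    · obtain ⟨⟨h4, h5⟩, h6, h7⟩ := hWr w hw
      rcases h3 with h | h | h | h <;> linarith
  have hvert : ∀ x : ℝ, x ∈ Icc r R → (x = r ∨ x = R) → ∀ u v : ℝ, -b ≤ u → u ≤ v → v ≤ b →
      IntervalIntegrable (fun y : ℝ => G (x + y * I)) volume u v ∧
      IntervalIntegrable (fun y : ℝ => G (x + y * I) * kernel h (x + y * I)) volume u v := by
    intro x hx hx' u v hu huv hv
    have key : ∀ y ∈ uIcc u v, ContinuousAt G (x + y * I) ∧
        ContinuousAt (kernel h) (x + y * I) := by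
      intro y hy
      rw [uIcc_of_le huv] at hy
      refine hbd _ (by simpa using hx) ?_ ?_
      · simpa using ⟨hu.trans hy.1, hy.2.trans hv⟩
      · simp only [add_re, ofReal_re, mul_re, I_re, mul_zero, ofReal_im, I_im, mul_one, sub_self,
          add_zero]
        tauto
    have hcont : ∀ H : ℂ → ℂ, (∀ y ∈ uIcc u v, ContinuousAt H (x + y * I)) →
        ContinuousOn (fun y : ℝ => H (x + y * I)) (uIcc u v) := fun H hH y hy =>
      ContinuousAt.comp_continuousWithinAt (g := H) (hH y hy) (by fun_prop)
    have h1 := hcont G fun y hy => (key y hy).1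
    have h2 := hcont (kernel h) fun y hy => (key y hy).2
    exact ⟨h1.intervalIntegrable, (h1.mul h2).intervalIntegrable⟩
  have hhor : IntervalIntegrable (fun x : ℝ => G (x + (-b : ℝ) * I)) volume r R ∧
      IntervalIntegrable (fun x : ℝ => G (x + (-b : ℝ) * I) * kernel h (x + (-b : ℝ) * I))
        volume r R := by
    have key : ∀ x ∈ uIcc r R, ContinuousAt G (x + (-b : ℝ) * I) ∧
        ContinuousAt (kernel h) (x + (-b : ℝ) * I) := by
      intro x hx
      rw [uIcc_of_le hrR] at hx
      refine hbd _ (by simpa using hx) (by simpa using hb.le) (by simp)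
    have hcont : ∀ H : ℂ → ℂ, (∀ x ∈ uIcc r R, ContinuousAt H (x + (-b : ℝ) * I)) →
        ContinuousOn (fun x : ℝ => H (x + (-b : ℝ) * I)) (uIcc r R) := fun H hH y hy =>
      ContinuousAt.comp_continuousWithinAt (g := H) (hH y hy) (by fun_prop)
    have h1 := hcont G fun y hy => (key y hy).1
    have h2 := hcont (kernel h) fun y hy => (key y hy).2
    exact ⟨h1.intervalIntegrable, (h1.mul h2).intervalIntegrable⟩
  have hrm : r ∈ Icc r R := ⟨le_rfl, hrR⟩
  have hRm : R ∈ Icc r R := ⟨hrR, le_rfl⟩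
  have e1 := intervalIntegral.integral_add_adjacent_intervals
    (hvert r hrm (Or.inl rfl) (-b) 0 le_rfl (by linarith) hb.le).2
    (hvert r hrm (Or.inl rfl) 0 b (by linarith) hb.le le_rfl).2
  have e2 := intervalIntegral.integral_add_adjacent_intervals
    (hvert R hRm (Or.inr rfl) (-b) 0 le_rfl (by linarith) hb.le).2
    (hvert R hRm (Or.inr rfl) 0 b (by linarith) hb.le le_rfl).2
  have e3 := intervalIntegral.integral_sub
    (hvert r hrm (Or.inl rfl) (-b) 0 le_rfl (by linarith) hb.le).2
    (hvert r hrm (Or.inl rfl) (-b) 0 le_rfl (by linarith) hb.le).1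
  have e4 := intervalIntegral.integral_sub
    (hvert R hRm (Or.inr rfl) (-b) 0 le_rfl (by linarith) hb.le).2
    (hvert R hRm (Or.inr rfl) (-b) 0 le_rfl (by linarith) hb.le).1
  have e5 := intervalIntegral.integral_sub hhor.2 hhor.1
  simp only [mul_sub, mul_one, e3, e4, e5]
  rw [← hsum, ← hnodes]
  simp only [rectInt, ofReal_zero, zero_mul, add_zero] at hfull hlow
  rw [← e1, ← e2] at hfull
  linear_combination hfull - hlow

/-! ### Bounds for the kernel -/

lemma norm_exp_kernel (h : ℝ) (w : ℂ) :
    ‖exp (-(2 * Real.pi * I * w ^ 2 / h))‖ = Real.exp (4 * Real.pi * w.re * w.im / h) := by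
  rw [Complex.norm_exp]
  congr 1
  have : -(2 * Real.pi * I * w ^ 2 / h) = ((-(2 * Real.pi / h) : ℝ) : ℂ) * (I * w ^ 2) := by
    push_cast; ring
  rw [this, re_ofReal_mul]
  simp [sq]
  ring

/-- The symmetry `kernel (conj w) = 1 - conj (kernel w)`, in the form of a norm identity. -/
lemma norm_kernel_sub_one {h : ℝ} {w : ℂ} (h1 : exp (-(2 * Real.pi * I * w ^ 2 / h)) ≠ 1) :
    ‖kernel h w - 1‖ = ‖kernel h ((starRingEnd ℂ) w)‖ := by
  have hc : exp (-(2 * Real.pi * I * ((starRingEnd ℂ) w) ^ 2 / h)) =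
      (starRingEnd ℂ) (exp (-(2 * Real.pi * I * w ^ 2 / h)))⁻¹ := by
    rw [← Complex.exp_neg, ← Complex.exp_conj]
    simp [neg_div, Complex.conj_ofNat]
  set E := exp (-(2 * Real.pi * I * w ^ 2 / h)) with hE
  have hE0 : E ≠ 0 := Complex.exp_ne_zero _
  have h2 : 1 - E ≠ 0 := sub_ne_zero.2 h1.symm
  have h3 : E - 1 ≠ 0 := sub_ne_zero.2 h1
  have h4 : kernel h w - 1 = -(1 - E⁻¹)⁻¹ := by
    rw [kernel, ← hE]
    have : 1 - E⁻¹ = (E - 1) / E := by field_simp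
    rw [this, inv_div]
    field_simp
    ring
  rw [h4, kernel, hc, norm_neg, norm_inv, norm_inv, ← Complex.norm_conj (1 - E⁻¹)]
  simp

lemma norm_kernel_le {h ρ a : ℝ} (hh : 0 < h) (hρ : 0 < ρ) (ha : 0 < a) {w : ℂ}
    (hre : ρ ≤ w.re) (him : a ≤ w.im) :
    ‖kernel h w‖ ≤ (1 - Real.exp (-(4 * Real.pi * ρ * a / h)))⁻¹ *
      Real.exp (-(4 * Real.pi * w.re * a / h)) := by
  have hpi := Real.pi_pos
  have hre0 : 0 < w.re := hρ.trans_le hre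
  set v := 4 * Real.pi * w.re * a / h with hv
  set v0 := 4 * Real.pi * ρ * a / h with hv0
  have hv0p : 0 < v0 := by positivity
  have hvv : v0 ≤ v := by rw [hv, hv0]; gcongr
  have hvE : v ≤ 4 * Real.pi * w.re * w.im / h := by rw [hv]; gcongr
  have h0 : 0 < 1 - Real.exp (-v0) := by
    rw [sub_pos, Real.exp_lt_one_iff]; linarith
  have h1 : (1 - Real.exp (-v0)) * Real.exp v ≤ ‖1 - exp (-(2 * Real.pi * I * w ^ 2 / h))‖ := by
    have h2 := norm_sub_norm_le (exp (-(2 * Real.pi * I * w ^ 2 / h))) 1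
    rw [norm_exp_kernel, norm_one, norm_sub_rev] at h2
    have h3 : Real.exp v ≤ Real.exp (4 * Real.pi * w.re * w.im / h) := Real.exp_le_exp.2 hvE
    have h4 : 1 ≤ Real.exp (-v0) * Real.exp v := by
      rw [← Real.exp_add]; exact Real.one_le_exp (by linarith)
    linarith
  rw [kernel, norm_inv, Real.exp_neg v, ← mul_inv]
  exact inv_anti₀ (mul_pos h0 (Real.exp_pos _)) h1

lemma norm_kernel_sub_one_le {h ρ a : ℝ} (hh : 0 < h) (hρ : 0 < ρ) (ha : 0 < a) {w : ℂ}
    (hre : ρ ≤ w.re) (him : w.im ≤ -a) :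
    ‖kernel h w - 1‖ ≤ (1 - Real.exp (-(4 * Real.pi * ρ * a / h)))⁻¹ *
      Real.exp (-(4 * Real.pi * w.re * a / h)) := by
  rw [norm_kernel_sub_one]
  · simpa using norm_kernel_le hh hρ ha (w := (starRingEnd ℂ) w) (by simpa using hre)
      (by simpa using by linarith)
  · intro h1
    have := (exp_kernel_eq_one hh (hρ.trans_le hre) h1).1
    linarith

lemma norm_one_sub_mul_mono {u : ℂ} (hu : ‖u‖ = 1) {A B : ℝ} (hA : 1 ≤ A) (hAB : A ≤ B) :
    ‖1 - A * u‖ ≤ ‖1 - B * u‖ := by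
  have hre : u.re ≤ 1 := hu ▸ Complex.re_le_norm u
  have hn : u.re ^ 2 + u.im ^ 2 = 1 := by
    have := Complex.sq_norm u
    rw [hu, Complex.normSq_apply] at this
    nlinarith
  rw [← sq_le_sq₀ (norm_nonneg _) (norm_nonneg _), Complex.sq_norm, Complex.sq_norm,
    Complex.normSq_apply, Complex.normSq_apply]
  simp only [sub_re, one_re, mul_re, ofReal_re, ofReal_im, zero_mul, sub_zero, sub_im, one_im,
    mul_im, add_zero]
  have e : ∀ t : ℝ, (1 - t * u.re) * (1 - t * u.re) + (0 - t * u.im) * (0 - t * u.im) =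
      1 - 2 * t * u.re + t ^ 2 := fun t => by linear_combination t ^ 2 * hn
  rw [e, e]
  nlinarith

/-- On vertical segments whose real part `r` has `r² / h` in a fixed nonzero class modulo one,
the kernel is bounded uniformly in `r`. -/
lemma exists_norm_kernel_le {h ρ b ν : ℝ} (hh : 0 < h) (hρ : 0 < ρ) (hb : 0 < b)
    (hν : ∀ k : ℤ, ν ≠ k) :
    ∃ M : ℝ, 0 < M ∧ ∀ r : ℝ, ρ ≤ r → (∃ k : ℤ, r ^ 2 = (ν + k) * h) → ∀ y : ℝ,
      (y ∈ Icc 0 b → ‖kernel h (r + y * I)‖ ≤ M) ∧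
      (y ∈ Icc (-b) 0 → ‖kernel h (r + y * I) - 1‖ ≤ M) := by
  have hpi := Real.pi_pos
  have hhc : (h : ℂ) ≠ 0 := by exact_mod_cast hh.ne'
  let u : ℝ → ℂ := fun y => exp (((-(2 * Real.pi * (ν - y ^ 2 / h)) : ℝ) : ℂ) * I)
  let φ : ℝ → ℝ := fun y => ‖1 - (Real.exp (4 * Real.pi * ρ * y / h) : ℝ) * u y‖
  have hu1 : ∀ y, ‖u y‖ = 1 := fun y => Complex.norm_exp_ofReal_mul_I _
  have hE : ∀ r y : ℝ, (∃ k : ℤ, r ^ 2 = (ν + k) * h) →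
      exp (-(2 * Real.pi * I * ((r : ℂ) + y * I) ^ 2 / h)) =
        (Real.exp (4 * Real.pi * r * y / h) : ℝ) * u y := by
    rintro r y ⟨k, hk⟩
    have hkc : (r : ℂ) ^ 2 = (ν + k) * h := by exact_mod_cast hk
    simp only [u]
    rw [Complex.ofReal_exp, ← Complex.exp_add, Complex.exp_eq_exp_iff_exists_int]
    refine ⟨-k, ?_⟩
    push_cast
    field_simp
    linear_combination (-2 * I) * hkc + (-4 * r * y - 2 * I * y ^ 2) * I_sq
  have hφ : ContinuousOn φ (Icc 0 b) := by
    apply Continuous.continuousOn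
    simp only [φ, u]
    fun_prop
  obtain ⟨y0, hy0, hmin⟩ := isCompact_Icc.exists_isMinOn ⟨0, by simpa using hb.le⟩ hφ
  have hpos : 0 < φ y0 := by
    refine lt_of_le_of_ne (norm_nonneg _) fun h0 => ?_
    have h1 : (1 : ℂ) = (Real.exp (4 * Real.pi * ρ * y0 / h) : ℝ) * u y0 :=
      sub_eq_zero.1 (norm_eq_zero.1 h0.symm)
    have h2 := congrArg norm h1
    rw [norm_one, norm_mul, hu1, mul_one, Complex.norm_real, Real.norm_eq_abs, Real.abs_exp] at h2
    have h3 : 4 * Real.pi * ρ * y0 / h = 0 := Real.exp_eq_one_iff _ |>.1 h2.symm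
    have h4 : y0 = 0 := by
      have : 4 * Real.pi * ρ / h * y0 = 0 := by rw [← h3]; ring
      exact (mul_eq_zero.1 this).resolve_left (by positivity)
    rw [h4] at h1
    simp only [u, mul_zero, zero_div, Real.exp_zero, ofReal_one, one_mul] at h1
    obtain ⟨n, hn⟩ := Complex.exp_eq_one_iff.1 h1.symm
    have h5 : (((-ν : ℝ)) : ℂ) * (2 * Real.pi * I) = ((n : ℝ) : ℂ) * (2 * Real.pi * I) := by
      push_cast
      rw [← ofReal_intCast] at hn
      push_cast at hn
      linear_combination hn
    have h6 := mul_right_cancel₀ Complex.two_pi_I_ne_zero h5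
    have h7 : -ν = n := by exact_mod_cast h6
    exact hν (-n) (by push_cast; linarith)
  have hup : ∀ r : ℝ, ρ ≤ r → (∃ k : ℤ, r ^ 2 = (ν + k) * h) → ∀ y ∈ Icc 0 b,
      φ y0 ≤ ‖1 - exp (-(2 * Real.pi * I * ((r : ℂ) + y * I) ^ 2 / h))‖ := by
    intro r hr hk y hy
    rw [hE r y hk]
    have hy' : 0 ≤ y := hy.1
    refine (hmin hy).trans (norm_one_sub_mul_mono (hu1 y) ?_ ?_)
    · exact Real.one_le_exp (by positivity)
    · exact Real.exp_le_exp.2 (by gcongr)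
  have hup' : ∀ r : ℝ, ρ ≤ r → (∃ k : ℤ, r ^ 2 = (ν + k) * h) → ∀ y ∈ Icc 0 b,
      ‖kernel h (r + y * I)‖ ≤ (φ y0)⁻¹ := by
    intro r hr hk y hy
    rw [kernel, norm_inv]
    exact inv_anti₀ hpos (hup r hr hk y hy)
  refine ⟨(φ y0)⁻¹, inv_pos.2 hpos, fun r hr hk y => ⟨hup' r hr hk y, fun hy => ?_⟩⟩
  rw [norm_kernel_sub_one]
  · have := hup' r hr hk (-y) ⟨by linarith [hy.2], by linarith [hy.1]⟩
    simpa using this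
  · intro h1
    obtain ⟨h2, -⟩ := exp_kernel_eq_one hh (by simpa using hρ.trans_le hr) h1
    have hy0 : y = 0 := by simpa using h2
    have := hup r hr hk 0 ⟨le_rfl, hb.le⟩
    rw [hy0] at h1
    rw [h1, sub_self, norm_zero] at this
    linarith

/-- The error bound resulting from `quadrature_identity`. -/
theorem quadrature_error_le {G : ℂ → ℂ} {h r R b : ℝ} {n : ℕ} (hh : 0 < h) (hr : 0 < r)
    (hrh : r ^ 2 < h) (hrR : r ≤ R) (hR : R ^ 2 = (n + 1 / 2) * h) (hb : 0 < b)
    (P : Finset ℂ) (hP : ∀ p ∈ P, p.re ∈ Ioo r R ∧ p.im ∈ Ioo (-b) b ∧ p.im ≠ 0)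
    (hG : ∀ w : ℂ, w.re ∈ Icc r R → w.im ∈ Icc (-b) b → w ∉ P → DifferentiableAt ℂ G w)
    (c : ℂ → ℂ) (hc : ∀ p ∈ P, Tendsto (fun w => (w - p) * G w) (𝓝[≠] p) (𝓝 (c p)))
    {B : ℝ} (hB : ∀ p ∈ P, ‖c p‖ * ‖if 0 < p.im then kernel h p else kernel h p - 1‖ ≤ B)
    {M S : ℝ} (hM : ∀ x : ℝ, x = r ∨ x = R → ∀ y : ℝ,
      (y ∈ Icc 0 b → ‖kernel h (x + y * I)‖ ≤ M) ∧
      (y ∈ Icc (-b) 0 → ‖kernel h (x + y * I) - 1‖ ≤ M))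
    (hS : ∀ x : ℝ, x = r ∨ x = R → ∀ y ∈ Icc (-b) b, ‖G (x + y * I)‖ ≤ S)
    {g : ℝ → ℝ} (hg : Continuous g)
    (hgu : ∀ x ∈ Icc r R, ‖G (x + b * I) * kernel h (x + b * I)‖ ≤ g x)
    (hgl : ∀ x ∈ Icc r R, ‖G (x + (-b : ℝ) * I) * (kernel h (x + (-b : ℝ) * I) - 1)‖ ≤ g x) :
    ‖(∫ x : ℝ in r..R, G x) -
        ∑ j ∈ Finset.Icc 1 n, h / (2 * (Real.sqrt (j * h) : ℂ)) * G (Real.sqrt (j * h))‖ ≤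
      2 * Real.pi * (P.card * B) + 2 * (∫ x in r..R, g x) + 4 * (S * M * b) := by
  rw [quadrature_identity hh hr hrh hrR hR hb P hP hG c hc]
  have hside : ∀ x : ℝ, x = r ∨ x = R →
      ‖I * ∫ y : ℝ in (-b)..0, G (x + y * I) * (kernel h (x + y * I) - 1)‖ ≤ S * M * b ∧
      ‖I * ∫ y : ℝ in (0 : ℝ)..b, G (x + y * I) * kernel h (x + y * I)‖ ≤ S * M * b := by
    intro x hx
    have hS0 : 0 ≤ S := (norm_nonneg _).trans (hS x hx 0 (by simpa using hb.le))
    constructor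
    · rw [norm_mul, norm_I, one_mul]
      have := intervalIntegral.norm_integral_le_of_norm_le_const (a := -b) (b := 0)
        (f := fun y : ℝ => G (x + y * I) * (kernel h (x + y * I) - 1)) (C := S * M) (by
          intro y hy
          rw [uIoc_of_le (by linarith)] at hy
          rw [norm_mul]
          have h1 := hS x hx y ⟨hy.1.le, hy.2.trans hb.le⟩
          have h2 := (hM x hx y).2 ⟨hy.1.le, hy.2⟩
          gcongr)
      rwa [zero_sub, neg_neg, abs_of_pos hb] at this
    · rw [norm_mul, norm_I, one_mul]
      have := intervalIntegral.norm_integral_le_of_norm_le_const (a := 0) (b := b)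
        (f := fun y : ℝ => G (x + y * I) * kernel h (x + y * I)) (C := S * M) (by
          intro y hy
          rw [uIoc_of_le hb.le] at hy
          rw [norm_mul]
          have h1 := hS x hx y ⟨by linarith [hy.1], hy.2⟩
          have h2 := (hM x hx y).1 ⟨hy.1.le, hy.2⟩
          gcongr)
      rwa [sub_zero, abs_of_pos hb] at this
  have hsum : ‖2 * Real.pi * I * ∑ p ∈ P, c p *
      (if 0 < p.im then kernel h p else kernel h p - 1)‖ ≤ 2 * Real.pi * (P.card * B) := by
    rw [norm_mul]
    have h1 : ‖(2 * Real.pi * I : ℂ)‖ = 2 * Real.pi := by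
      simp [abs_of_pos Real.pi_pos]
    rw [h1]
    refine mul_le_mul_of_nonneg_left ?_ (by positivity)
    refine (norm_sum_le_of_le P (fun p hp => ?_)).trans (by simp : ∑ p ∈ P, B ≤ P.card * B)
    rw [norm_mul]
    exact hB p hp
  have hup : ‖∫ x : ℝ in r..R, G (x + b * I) * kernel h (x + b * I)‖ ≤ ∫ x in r..R, g x :=
    intervalIntegral.norm_integral_le_of_norm_le hrR
      (Eventually.of_forall fun x hx => hgu x (Ioc_subset_Icc_self hx)) (hg.intervalIntegrable _ _)
  have hlo : ‖∫ x : ℝ in r..R, G (x + (-b : ℝ) * I) * (kernel h (x + (-b : ℝ) * I) - 1)‖ ≤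
      ∫ x in r..R, g x :=
    intervalIntegral.norm_integral_le_of_norm_le hrR
      (Eventually.of_forall fun x hx => hgl x (Ioc_subset_Icc_self hx)) (hg.intervalIntegrable _ _)
  obtain ⟨hr1, hr2⟩ := hside r (Or.inl rfl)
  obtain ⟨hR1, hR2⟩ := hside R (Or.inr rfl)
  refine (norm_add_le _ _).trans ?_
  refine (add_le_add (norm_add_le _ _) le_rfl).trans ?_
  refine (add_le_add (add_le_add (norm_sub_le _ _) le_rfl) le_rfl).trans ?_
  refine (add_le_add (add_le_add (add_le_add (norm_sub_le _ _) le_rfl) le_rfl) le_rfl).trans ?_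
  refine (add_le_add (add_le_add (add_le_add (add_le_add (norm_add_le _ _) le_rfl) le_rfl)
    le_rfl) le_rfl).trans ?_
  refine (add_le_add (add_le_add (add_le_add (add_le_add (add_le_add (norm_sub_le _ _) le_rfl)
    le_rfl) le_rfl) le_rfl) le_rfl).trans ?_
  linarith

/-! ### The integrand in the variable `w = √u`, its poles and residues -/

/-- The function `X(w) = C exp ((w - T) / α)`, through which the poles of the integrand are
described: they are the solutions of `X(w) = -y`, where `y` is `z` or one of the nodes. -/
noncomputable def expScale (α C T : ℝ) (w : ℂ) : ℂ := C * exp ((w - T) / α)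

/-- The integrand after the substitution `u = w²`, for arbitrary nodes `s k`. -/
noncomputable def integrandSqrt (α C T : ℝ) (s : ℕ → ℝ) (m l : ℕ) (z w : ℂ) : ℂ :=
  z * ((C ^ α : ℝ) * (w - T) ^ l * exp (w - T)) / (expScale α C T w + z) *
    ∏ k ∈ Finset.Icc 1 m, (z - s k) / (expScale α C T w + s k)

lemma norm_expScale {α C : ℝ} (hC : 0 < C) (T : ℝ) (w : ℂ) :
    ‖expScale α C T w‖ = C * Real.exp ((w.re - T) / α) := by
  rw [expScale, norm_mul, Complex.norm_exp, Complex.norm_real, Real.norm_of_nonneg hC.le]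
  congr 2
  rw [div_ofReal_re]
  simp

lemma expScale_ofReal (α C T x : ℝ) :
    expScale α C T x = (C * Real.exp ((x - T) / α) : ℝ) := by
  simp [expScale]

lemma expScale_add_period {α : ℝ} (hα : 0 < α) (C T x : ℝ) :
    expScale α C T (x + (2 * Real.pi * α : ℝ) * I) = (C * Real.exp ((x - T) / α) : ℝ) := by
  have hac : (α : ℂ) ≠ 0 := by exact_mod_cast hα.ne'
  rw [← expScale_ofReal, expScale, expScale]
  congr 1
  rw [Complex.exp_eq_exp_iff_exists_int]
  refine ⟨1, ?_⟩
  push_cast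
  field_simp
  ring

lemma expScale_sub_period {α : ℝ} (hα : 0 < α) (C T x : ℝ) :
    expScale α C T (x + (-(2 * Real.pi * α) : ℝ) * I) = (C * Real.exp ((x - T) / α) : ℝ) := by
  have hac : (α : ℂ) ≠ 0 := by exact_mod_cast hα.ne'
  rw [← expScale_ofReal, expScale, expScale]
  congr 1
  rw [Complex.exp_eq_exp_iff_exists_int]
  refine ⟨-1, ?_⟩
  push_cast
  field_simp
  ring

lemma differentiable_expScale (α C T : ℝ) : Differentiable ℂ (expScale α C T) := by
  unfold expScale; fun_prop

lemma hasDerivAt_expScale (α C T : ℝ) (w : ℂ) :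
    HasDerivAt (expScale α C T) (expScale α C T w / α) w := by
  have h1 : HasDerivAt (fun w : ℂ => (w - T) / (α : ℂ)) (1 / α) w :=
    ((hasDerivAt_id w).sub_const (T : ℂ)).div_const (α : ℂ)
  refine (h1.cexp.const_mul (C : ℂ)).congr_deriv ?_
  rw [expScale]; ring

lemma differentiableAt_integrandSqrt {α C T : ℝ} {s : ℕ → ℝ} {m l : ℕ} {z w : ℂ}
    (hz : expScale α C T w + z ≠ 0) (hs : ∀ k ∈ Finset.Icc 1 m, expScale α C T w + s k ≠ 0) :
    DifferentiableAt ℂ (integrandSqrt α C T s m l z) w := by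
  have hX : DifferentiableAt ℂ (expScale α C T) w := differentiable_expScale α C T w
  unfold integrandSqrt
  refine DifferentiableAt.mul (DifferentiableAt.div (by fun_prop) (by fun_prop) hz) ?_
  refine DifferentiableAt.fun_finsetProd fun k hk => DifferentiableAt.div (by fun_prop)
    (by fun_prop) (hs k hk)

/-- The points `T + α (log (y / C) ± π i)`, the two solutions of `X(w) = -y` in the strip
`|Im w| < 2 π α`. -/
noncomputable def polePoint (α C T : ℝ) (y : ℂ) (ε : ℝ) : ℂ :=
  T + α * (Complex.log (y / C) + ε * Real.pi * I)

lemma eq_polePoint {α C T : ℝ} (hα : 0 < α) (hC : 0 < C) {y w : ℂ} (hy : y ≠ 0)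
    (harg : |y.arg| < Real.pi) (him : |w.im| ≤ 2 * Real.pi * α) (hw : expScale α C T w = -y) :
    w = polePoint α C T y 1 ∨ w = polePoint α C T y (-1) := by
  have hpi := Real.pi_pos
  have hac : (α : ℂ) ≠ 0 := by exact_mod_cast hα.ne'
  have hCc : (C : ℂ) ≠ 0 := by exact_mod_cast hC.ne'
  have hyC : y / C ≠ 0 := div_ne_zero hy hCc
  have h1 : exp ((w - T) / α) = exp (Complex.log (y / C) + Real.pi * I) := by
    rw [Complex.exp_add, Complex.exp_log hyC, Complex.exp_pi_mul_I]
    rw [expScale] at hw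
    field_simp
    linear_combination hw
  obtain ⟨n, hn⟩ := Complex.exp_eq_exp_iff_exists_int.1 h1
  have hlim : (Complex.log (y / C)).im = y.arg := by
    rw [Complex.log_im, div_eq_inv_mul, ← ofReal_inv, arg_real_mul _ (inv_pos.2 hC)]
  have h2 := congrArg Complex.im hn
  rw [div_ofReal_im] at h2
  simp only [sub_im, ofReal_im, sub_zero, add_im, hlim, mul_im, ofReal_re, I_im, mul_one, I_re,
    mul_zero, add_zero, intCast_re, intCast_im, zero_mul, mul_re, re_ofNat, im_ofNat,
    sub_self] at h2
  have h3 : |w.im / α| ≤ 2 * Real.pi := by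
    rw [abs_div, abs_of_pos hα, div_le_iff₀ hα]; exact him
  rw [h2, abs_le] at h3
  rw [abs_lt] at harg
  have hn1 : (n : ℝ) < 1 := by
    by_contra hcon
    nlinarith [mul_le_mul_of_nonneg_right (not_lt.1 hcon) hpi.le]
  have hn2 : (-2 : ℝ) < n := by
    by_contra hcon
    nlinarith [mul_le_mul_of_nonneg_right (not_lt.1 hcon) hpi.le]
  have hn1' : n < 1 := by exact_mod_cast hn1
  have hn2' : -2 < n := by exact_mod_cast hn2
  obtain rfl | rfl : n = 0 ∨ n = -1 := by omega
  · left
    rw [polePoint]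
    field_simp at hn
    push_cast at hn ⊢
    linear_combination hn
  · right
    rw [polePoint]
    field_simp at hn
    push_cast at hn ⊢
    linear_combination hn

lemma polePoint_im_bounds {α C T : ℝ} (hα : 0 < α) (hC : 0 < C) {y : ℂ} {θ : ℝ}
    (hθ : θ < Real.pi) (harg : |y.arg| ≤ θ) {ε : ℝ} (hε : ε = 1 ∨ ε = -1) :
    α * (Real.pi - θ) ≤ |(polePoint α C T y ε).im| ∧
      |(polePoint α C T y ε).im| < 2 * Real.pi * α := by
  have hlim : (Complex.log (y / C)).im = y.arg := by
    rw [Complex.log_im, div_eq_inv_mul, ← ofReal_inv, arg_real_mul _ (inv_pos.2 hC)]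
  have him : (polePoint α C T y ε).im = α * (y.arg + ε * Real.pi) := by
    rw [polePoint, add_im, ofReal_im, im_ofReal_mul, add_im, hlim]
    simp
  rw [him, abs_mul, abs_of_pos hα, mul_comm (2 * Real.pi) α]
  rw [abs_le] at harg
  refine ⟨mul_le_mul_of_nonneg_left ?_ hα.le, mul_lt_mul_of_pos_left ?_ hα⟩
  · rcases hε with rfl | rfl
    · exact le_abs.2 (Or.inl (by linarith))
    · exact le_abs.2 (Or.inr (by linarith))
  · rw [abs_lt]
    rcases hε with rfl | rfl <;> constructor <;> linarith

lemma expScale_polePoint {α C T : ℝ} (hα : 0 < α) (hC : 0 < C) {y : ℂ} (hy : y ≠ 0)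
    {ε : ℝ} (hε : ε = 1 ∨ ε = -1) : expScale α C T (polePoint α C T y ε) = -y := by
  have hac : (α : ℂ) ≠ 0 := by exact_mod_cast hα.ne'
  have hCc : (C : ℂ) ≠ 0 := by exact_mod_cast hC.ne'
  rw [expScale, polePoint, add_sub_cancel_left, mul_div_cancel_left₀ _ hac, Complex.exp_add,
    Complex.exp_log (div_ne_zero hy hCc)]
  have : exp ((ε : ℂ) * Real.pi * I) = -1 := by
    rcases hε with rfl | rfl
    · simp [Complex.exp_pi_mul_I]
    · simp [Complex.exp_neg, Complex.exp_pi_mul_I]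
  rw [this]
  field_simp

lemma norm_sub_le_six {z : ℂ} (hz : ‖z‖ ≤ 1) {t : ℝ} (ht : 1 < t) (ht5 : t ≤ 5) :
    ‖z - t‖ ≤ 6 := by
  have := norm_sub_le z t
  rw [Complex.norm_real, Real.norm_of_nonneg (by linarith)] at this
  linarith

lemma sub_ofReal_ne_zero {z : ℂ} (hz : ‖z‖ ≤ 1) {t : ℝ} (ht : 1 < t) : z - t ≠ 0 := by
  intro h
  rw [sub_eq_zero.1 h, Complex.norm_real, Real.norm_of_nonneg (by linarith)] at hz
  linarith

/-- The pole coming from `z`. Its residue carries no singular factor, since `X(p) = -z` turns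
each factor of the product into `-1`. -/
lemma exists_residue_left {α C T d : ℝ} {s : ℕ → ℝ} {m l : ℕ} {z p : ℂ} (hα : 0 < α)
    (hC : 0 < C) (hd : 0 < d) (hd1 : d ≤ 1) (hz0 : z ≠ 0) (hz : ‖z‖ ≤ 1)
    (hs : ∀ k ∈ Finset.Icc 1 m, 1 < s k ∧ s k ≤ 5) (hp : expScale α C T p = -z) :
    ∃ c : ℂ, Tendsto (fun w => (w - p) * integrandSqrt α C T s m l z w) (𝓝[≠] p) (𝓝 c) ∧
      ‖c‖ ≤ α * C ^ α * (6 / d) ^ m * (‖p - T‖ ^ l * Real.exp (p.re - T)) := by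
  have hac : (α : ℂ) ≠ 0 := by exact_mod_cast hα.ne'
  have hder : HasDerivAt (fun w => expScale α C T w + z) (-z / α) p := by
    rw [← hp]; exact (hasDerivAt_expScale α C T p).add_const z
  have h1 := tendsto_sub_mul_inv_of_hasDerivAt hder (by rw [hp]; ring)
    (div_ne_zero (neg_ne_zero.2 hz0) hac)
  have hX : ContinuousAt (expScale α C T) p := (differentiable_expScale α C T p).continuousAt
  have h2 : ContinuousAt (fun w => z * ((C ^ α : ℝ) * (w - T) ^ l * exp (w - T)) *
      ∏ k ∈ Finset.Icc 1 m, (z - s k) / (expScale α C T w + s k)) p := by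
    refine ContinuousAt.mul (by fun_prop) (tendsto_finsetProd _ fun k hk => ?_)
    refine ContinuousAt.div (by fun_prop) (by fun_prop) ?_
    rw [hp]
    intro h
    exact sub_ofReal_ne_zero hz (hs k hk).1 (by linear_combination -h)
  refine ⟨_, (h1.mul (h2.tendsto.mono_left nhdsWithin_le_nhds)).congr fun w => ?_, ?_⟩
  · rw [integrandSqrt, div_eq_mul_inv]; ring
  · have hprod : ‖∏ k ∈ Finset.Icc 1 m, (z - s k) / (expScale α C T p + s k)‖ ≤ (6 / d) ^ m := by
      rw [norm_prod]
      have h6 : (1 : ℝ) ≤ 6 / d := by rw [le_div_iff₀ hd]; linarith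
      refine (Finset.prod_le_one (fun _ _ => norm_nonneg _) fun k hk => ?_).trans
        (one_le_pow₀ h6)
      have : expScale α C T p + s k = -(z - s k) := by rw [hp]; ring
      rw [this, norm_div, norm_neg, div_self (norm_ne_zero_iff.2
        (sub_ofReal_ne_zero hz (hs k hk).1))]
    have hzn : 0 < ‖z‖ := norm_pos_iff.2 hz0
    have hCa : 0 < C ^ α := Real.rpow_pos_of_pos hC α
    simp only [norm_mul, norm_inv, norm_div, norm_neg, norm_pow, Complex.norm_exp,
      Complex.norm_real, Real.norm_of_nonneg hα.le, Real.norm_of_nonneg hCa.le, sub_re, ofReal_re]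
    rw [inv_div]
    calc α / ‖z‖ * (‖z‖ * (C ^ α * ‖p - T‖ ^ l * Real.exp (p.re - T)) * _)
        = α * C ^ α * ‖∏ k ∈ Finset.Icc 1 m, (z - s k) / (expScale α C T p + s k)‖ *
          (‖p - T‖ ^ l * Real.exp (p.re - T)) := by field_simp
      _ ≤ _ := by gcongr

/-- The poles coming from the nodes. -/
lemma exists_residue_node {α C T d : ℝ} {s : ℕ → ℝ} {m l i : ℕ} {z p : ℂ} (hα : 0 < α)
    (hC : 0 < C) (hd : 0 < d) (hd1 : d ≤ 1) (hz : ‖z‖ ≤ 1)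
    (hs : ∀ k ∈ Finset.Icc 1 m, 1 < s k ∧ s k ≤ 5)
    (hsd : ∀ j ∈ Finset.Icc 1 m, ∀ k ∈ Finset.Icc 1 m, j ≠ k → d ≤ |s j - s k|)
    (hi : i ∈ Finset.Icc 1 m) (hp : expScale α C T p = -(s i : ℂ)) :
    ∃ c : ℂ, Tendsto (fun w => (w - p) * integrandSqrt α C T s m l z w) (𝓝[≠] p) (𝓝 c) ∧
      ‖c‖ ≤ α * C ^ α * (6 / d) ^ m * (‖p - T‖ ^ l * Real.exp (p.re - T)) := by
  have hac : (α : ℂ) ≠ 0 := by exact_mod_cast hα.ne'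
  have hsi := hs i hi
  have hsi0 : (s i : ℂ) ≠ 0 := by exact_mod_cast (zero_lt_one.trans hsi.1).ne'
  have hder : HasDerivAt (fun w => expScale α C T w + s i) (-(s i : ℂ) / α) p := by
    rw [← hp]; exact (hasDerivAt_expScale α C T p).add_const _
  have h1 := tendsto_sub_mul_inv_of_hasDerivAt hder (by rw [hp]; ring)
    (div_ne_zero (neg_ne_zero.2 hsi0) hac)
  have hX : ContinuousAt (expScale α C T) p := (differentiable_expScale α C T p).continuousAt
  have hzi : expScale α C T p + z = z - s i := by rw [hp]; ring
  have h2 : ContinuousAt (fun w => z * ((C ^ α : ℝ) * (w - T) ^ l * exp (w - T)) *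
      (expScale α C T w + z)⁻¹ * (z - s i) *
      ∏ k ∈ (Finset.Icc 1 m).erase i, (z - s k) / (expScale α C T w + s k)) p := by
    refine ContinuousAt.mul (ContinuousAt.mul (ContinuousAt.mul (by fun_prop)
      (ContinuousAt.inv₀ (by fun_prop) ?_)) continuousAt_const)
      (tendsto_finsetProd _ fun k hk => ?_)
    · rw [hzi]; exact sub_ofReal_ne_zero hz hsi.1
    · refine ContinuousAt.div (by fun_prop) (by fun_prop) ?_
      rw [hp]
      intro h
      have hk' := Finset.mem_erase.1 hk
      have h3 : ((s k - s i : ℝ) : ℂ) = 0 := by push_cast; linear_combination h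
      have h4 := hsd k hk'.2 i hi hk'.1
      rw [ofReal_eq_zero.1 h3, abs_zero] at h4
      linarith
  refine ⟨_, (h1.mul (h2.tendsto.mono_left nhdsWithin_le_nhds)).congr fun w => ?_, ?_⟩
  · rw [integrandSqrt, ← Finset.mul_prod_erase _ _ hi]
    simp only [div_eq_mul_inv]; ring
  · have h6 : (1 : ℝ) ≤ 6 / d := by rw [le_div_iff₀ hd]; linarith
    have hprod : ‖∏ k ∈ (Finset.Icc 1 m).erase i, (z - s k) / (expScale α C T p + s k)‖ ≤
        (6 / d) ^ m := by
      rw [norm_prod]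
      refine (Finset.prod_le_prod (fun _ _ => norm_nonneg _) (fun k hk => ?_)).trans
        ((Finset.prod_const (6 / d)).le.trans
          (pow_le_pow_right₀ h6 ((Finset.card_erase_le).trans (by simp))))
      have hk' := Finset.mem_erase.1 hk
      have : expScale α C T p + s k = ((s k - s i : ℝ) : ℂ) := by rw [hp]; push_cast; ring
      rw [this, norm_div, Complex.norm_real, Real.norm_eq_abs]
      exact div_le_div₀ (by norm_num) (norm_sub_le_six hz (hs k hk'.2).1 (hs k hk'.2).2) hd
        (hsd k hk'.2 i hi hk'.1)
    have hCa : 0 < C ^ α := Real.rpow_pos_of_pos hC α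
    have hzs : 0 < ‖z - s i‖ := norm_pos_iff.2 (sub_ofReal_ne_zero hz hsi.1)
    have hsp : 0 < s i := zero_lt_one.trans hsi.1
    simp only [hzi, norm_mul, norm_inv, norm_div, norm_neg, norm_pow, Complex.norm_exp,
      Complex.norm_real, Real.norm_of_nonneg hα.le, Real.norm_of_nonneg hCa.le,
      Real.norm_of_nonneg hsp.le, sub_re, ofReal_re]
    rw [inv_div]
    have hzs1 : ‖z‖ / s i ≤ 1 := by rw [div_le_one hsp]; linarith
    calc α / s i * (‖z‖ * (C ^ α * ‖p - T‖ ^ l * Real.exp (p.re - T)) * ‖z - s i‖⁻¹ *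
          ‖z - s i‖ * _)
        = ‖z‖ / s i * (α * C ^ α * ‖∏ k ∈ (Finset.Icc 1 m).erase i,
          (z - s k) / (expScale α C T p + s k)‖ *
          (‖p - T‖ ^ l * Real.exp (p.re - T))) := by field_simp
      _ ≤ 1 * (α * C ^ α * (6 / d) ^ m * (‖p - T‖ ^ l * Real.exp (p.re - T))) := by gcongr
      _ = _ := one_mul _

/-- If `X + y` is comparable to `|X| + |y|` for `y = z` and for all nodes, then the integrand
decays like `exp (Re w - T)` to the left and like `exp (-(Re w - T) / κ)` to the right. -/
lemma norm_integrandSqrt_le {α C T κ c : ℝ} {s : ℕ → ℝ} {m l : ℕ} {z w : ℂ}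
    (hC : 0 < C) (hκ : 1 / κ = (m + 1) / α - 1) (hc : 0 < c) (hz : ‖z‖ ≤ 1)
    (hs : ∀ k ∈ Finset.Icc 1 m, 1 < s k ∧ s k ≤ 5)
    (hXz : c * (‖expScale α C T w‖ + ‖z‖) ≤ ‖expScale α C T w + z‖)
    (hXs : ∀ k ∈ Finset.Icc 1 m,
      c * (‖expScale α C T w‖ + s k) ≤ ‖expScale α C T w + s k‖) :
    ‖integrandSqrt α C T s m l z w‖ ≤
      C ^ α * (1 / c) * (6 / c) ^ m * max 1 ((C ^ (m + 1))⁻¹) *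
        (‖w - T‖ ^ l * min (Real.exp (w.re - T)) (Real.exp (-((w.re - T) / κ)))) := by
  set τ := w.re - T with hτ
  set q := ‖expScale α C T w‖ with hq
  have hqv : q = C * Real.exp (τ / α) := norm_expScale hC T w
  have hq0 : 0 < q := by rw [hqv]; positivity
  have hCa : 0 < C ^ α := Real.rpow_pos_of_pos hC α
  have h1 : ‖z‖ / ‖expScale α C T w + z‖ ≤ 1 / c * (1 / (1 + q)) := by
    have hpos : 0 < c * (q + ‖z‖) := by positivity
    rw [div_mul_div_comm, one_mul]
    rw [div_le_div_iff₀ (hpos.trans_le hXz) (by positivity)]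
    have : ‖z‖ * (1 + q) ≤ q + ‖z‖ := by nlinarith [norm_nonneg z]
    nlinarith [mul_le_mul_of_nonneg_left this hc.le]
  have h2 : ‖∏ k ∈ Finset.Icc 1 m, (z - s k) / (expScale α C T w + s k)‖ ≤
      (6 / c * (1 / (1 + q))) ^ m := by
    rw [norm_prod]
    refine (Finset.prod_le_prod (fun _ _ => norm_nonneg _) (fun k hk => ?_)).trans
      (by simp : ∏ k ∈ Finset.Icc 1 m, (6 / c * (1 / (1 + q))) ≤ _)
    obtain ⟨hs1, hs5⟩ := hs k hk
    rw [norm_div, div_mul_div_comm, mul_one]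
    refine div_le_div₀ (by norm_num) (norm_sub_le_six hz hs1 hs5) (by positivity)
      (le_trans ?_ (hXs k hk))
    nlinarith
  have h3 : Real.exp τ * (1 / (1 + q)) ^ (m + 1) ≤ max 1 ((C ^ (m + 1))⁻¹) *
      min (Real.exp τ) (Real.exp (-(τ / κ))) := by
    have hle : (1 / (1 + q)) ^ (m + 1) ≤ 1 :=
      pow_le_one₀ (by positivity) (by rw [div_le_one (by positivity)]; linarith)
    rcases min_choice (Real.exp τ) (Real.exp (-(τ / κ))) with h | h <;> rw [h]
    · rw [mul_comm]
      exact mul_le_mul_of_nonneg_right (hle.trans (le_max_left _ _)) (Real.exp_pos _).le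
    · have h4 : (1 / (1 + q)) ^ (m + 1) ≤ (1 / q) ^ (m + 1) := by
        gcongr
        linarith
      have h5 : Real.exp τ * (1 / q) ^ (m + 1) = (C ^ (m + 1))⁻¹ * Real.exp (-(τ / κ)) := by
        rw [hqv, one_div, inv_pow, mul_pow, ← Real.exp_nat_mul, mul_inv, ← Real.exp_neg,
          mul_left_comm, ← Real.exp_add]
        congr 2
        rw [div_eq_mul_one_div τ κ, hκ]
        push_cast
        ring
      calc _ ≤ Real.exp τ * (1 / q) ^ (m + 1) := by gcongr
        _ = (C ^ (m + 1))⁻¹ * Real.exp (-(τ / κ)) := h5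
        _ ≤ _ := mul_le_mul_of_nonneg_right (le_max_right _ _) (Real.exp_pos _).le
  have hnorm : ‖integrandSqrt α C T s m l z w‖ = C ^ α * ‖w - T‖ ^ l * Real.exp τ *
      (‖z‖ / ‖expScale α C T w + z‖) *
      ‖∏ k ∈ Finset.Icc 1 m, (z - s k) / (expScale α C T w + s k)‖ := by
    rw [integrandSqrt, norm_mul, norm_div, norm_mul, norm_mul, norm_mul, norm_pow,
      Complex.norm_exp, Complex.norm_real, Real.norm_of_nonneg hCa.le, sub_re, ofReal_re]
    ring
  rw [hnorm]
  calc _ ≤ C ^ α * ‖w - T‖ ^ l * Real.exp τ * (1 / c * (1 / (1 + q))) *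
        (6 / c * (1 / (1 + q))) ^ m := by gcongr
    _ = C ^ α * (1 / c) * (6 / c) ^ m * ‖w - T‖ ^ l *
        (Real.exp τ * (1 / (1 + q)) ^ (m + 1)) := by rw [mul_pow, pow_succ]; ring
    _ ≤ C ^ α * (1 / c) * (6 / c) ^ m * ‖w - T‖ ^ l * (max 1 ((C ^ (m + 1))⁻¹) *
      min (Real.exp τ) (Real.exp (-(τ / κ)))) := by gcongr
    _ = _ := by ring

/-! ### The sector, the nodes and the change of variables -/

lemma norm_add_ge_of_separated {X y : ℂ} {μ : ℝ} (hμ : 0 < μ)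
    (h : (1 + μ) * ‖y‖ ≤ ‖X‖ ∨ (1 + μ) * ‖X‖ ≤ ‖y‖) :
    μ / (2 + μ) * (‖X‖ + ‖y‖) ≤ ‖X + y‖ := by
  rw [div_mul_eq_mul_div, div_le_iff₀ (by linarith)]
  rcases h with h | h
  · have h1 := norm_sub_norm_le X (-y)
    rw [norm_neg, sub_neg_eq_add] at h1
    nlinarith
  · have h1 := norm_sub_norm_le y (-X)
    rw [norm_neg, sub_neg_eq_add, add_comm y X] at h1
    nlinarith

/-- The constant `cos (θ / 2)`, in the form in which it is the optimal `c` in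
`c (q + |y|) ≤ |q + y|` for `q ≥ 0` and `|arg y| ≤ θ`. -/
noncomputable def sectorConst (θ : ℝ) : ℝ := Real.sqrt ((1 + Real.cos θ) / 2)

lemma sectorConst_pos {θ : ℝ} (h0 : 0 ≤ θ) (hθ : θ < Real.pi) : 0 < sectorConst θ := by
  refine Real.sqrt_pos.2 ?_
  have := Real.cos_lt_cos_of_nonneg_of_le_pi h0 le_rfl hθ
  rw [Real.cos_pi] at this
  linarith

lemma norm_ofReal_add_ge {q θ : ℝ} (hq : 0 ≤ q) {y : ℂ} (hθ : θ ≤ Real.pi)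
    (hy : |y.arg| ≤ θ) : sectorConst θ * (q + ‖y‖) ≤ ‖(q : ℂ) + y‖ := by
  have hre : Real.cos θ * ‖y‖ ≤ y.re := by
    rw [← Complex.norm_mul_cos_arg, mul_comm, ← Real.cos_abs y.arg]
    exact mul_le_mul_of_nonneg_left
      (Real.cos_le_cos_of_nonneg_of_le_pi (abs_nonneg _) hθ hy) (norm_nonneg _)
  have hc1 := Real.neg_one_le_cos θ
  have hc2 := Real.cos_le_one θ
  have hn := Complex.sq_norm y
  rw [Complex.normSq_apply] at hn
  rw [← sq_le_sq₀ (by unfold sectorConst; positivity) (norm_nonneg _), mul_pow, sectorConst,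
    Real.sq_sqrt (by linarith), Complex.sq_norm, Complex.normSq_apply]
  simp only [add_re, ofReal_re, add_im, ofReal_im, zero_add]
  nlinarith [mul_nonneg (by linarith : 0 ≤ 1 - Real.cos θ) (sq_nonneg (q - ‖y‖)),
    mul_le_mul_of_nonneg_left hre hq]

lemma sector_spec {β : ℝ} (hβ₂ : β < 2) {z : ℂ} (hz : z ∈ sector β) :
    ‖z‖ ≤ 1 ∧ |z.arg| ≤ β * Real.pi / 2 := by
  have hpi := Real.pi_pos
  obtain ⟨x, hx, θ, hθ, h⟩ := hz
  have hφ0 : 0 ≤ θ * Real.pi / 2 := by have := hθ.1; positivity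
  have hφ : θ * Real.pi / 2 ≤ β * Real.pi / 2 := by have := hθ.2; gcongr
  have hφ2 : θ * Real.pi / 2 < Real.pi := by nlinarith [hθ.2]
  have key : ∀ φ : ℝ, |φ| = θ * Real.pi / 2 → z = (x : ℂ) * exp (φ * I) →
      ‖z‖ ≤ 1 ∧ |z.arg| ≤ β * Real.pi / 2 := by
    rintro φ hφa rfl
    have h1 : -Real.pi < φ := by linarith [neg_abs_le φ]
    have h2 : φ ≤ Real.pi := by linarith [le_abs_self φ]
    constructor
    · rw [norm_mul, Complex.norm_exp_ofReal_mul_I, mul_one, Complex.norm_real,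
        Real.norm_of_nonneg hx.1]
      exact hx.2
    · rcases hx.1.eq_or_lt with h0 | h0
      · rw [← h0]; simp; linarith
      · rw [Complex.exp_mul_I, Complex.arg_mul_cos_add_sin_mul_I h0 ⟨h1, h2⟩, hφa]
        exact hφ
  rcases h with h | h
  · exact key _ (abs_of_nonneg hφ0) h
  · refine key (-(θ * Real.pi / 2)) (by rw [abs_neg, abs_of_nonneg hφ0]) ?_
    rw [h]; push_cast; ring_nf

lemma nodeDelta_ge (β : ℝ) : 1 ≤ nodeDelta β ∧ 0 < nodeOmega β ∧
    nodeDelta β + 2 * nodeOmega β ≤ 5 := by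
  have h1 : (1 : ℝ) ≤ Real.sqrt 2 := Real.one_le_sqrt.2 (by norm_num)
  have h2 : Real.sqrt 2 ≤ 3 / 2 := Real.sqrt_le_iff.2 ⟨by norm_num, by norm_num⟩
  unfold nodeDelta nodeOmega
  split_ifs
  · exact ⟨h1, by linarith, by linarith⟩
  · norm_num

lemma nodeAngle_mem {m k : ℕ} (hk : k ∈ Finset.Icc 1 m) :
    (2 * (m : ℝ) - 2 * (k : ℝ) + 1) * Real.pi / (2 * (m : ℝ)) ∈ Ioo 0 Real.pi := by
  have hpi := Real.pi_pos
  rw [Finset.mem_Icc] at hk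
  have hk1 : (1 : ℝ) ≤ k := by exact_mod_cast hk.1
  have hkm : (k : ℝ) ≤ m := by exact_mod_cast hk.2
  constructor
  · exact div_pos (mul_pos (by linarith) hpi) (by linarith)
  · rw [div_lt_iff₀ (by linarith)]
    nlinarith

lemma node_bounds {β : ℝ} {m k : ℕ} (hk : k ∈ Finset.Icc 1 m) :
    1 < node β m k ∧ node β m k ≤ 5 := by
  obtain ⟨h1, h2, h3⟩ := nodeDelta_ge β
  have h4 := nodeAngle_mem hk
  have h5 := Real.cos_lt_cos_of_nonneg_of_le_pi h4.1.le le_rfl h4.2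
  rw [Real.cos_pi] at h5
  have h6 := Real.cos_le_one ((2 * (m : ℝ) - 2 * (k : ℝ) + 1) * Real.pi / (2 * (m : ℝ)))
  unfold node
  constructor <;> nlinarith

lemma node_injOn (β : ℝ) (m : ℕ) : Set.InjOn (node β m) (Finset.Icc 1 m) := by
  intro j hj k hk hjk
  have hj' := nodeAngle_mem hj
  have hk' := nodeAngle_mem hk
  have h1 : (1 : ℝ) ≤ m := by
    have := Finset.mem_Icc.1 hj
    exact_mod_cast this.1.trans this.2
  unfold node at hjk
  have h2 := mul_left_cancel₀ (nodeDelta_ge β).2.1.ne' (add_left_cancel hjk)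
  have h3 := Real.injOn_cos (Ioo_subset_Icc_self hj') (Ioo_subset_Icc_self hk')
    (add_left_cancel h2)
  have h4 := mul_right_cancel₀ Real.pi_ne_zero
    ((div_left_inj' (by linarith : (2 * (m : ℝ)) ≠ 0)).1 h3)
  have : (j : ℝ) = k := by linarith
  exact_mod_cast this

lemma exists_separation (F : Finset ℕ) {s : ℕ → ℝ} (hs : Set.InjOn s F) :
    ∃ d : ℝ, 0 < d ∧ d ≤ 1 ∧ ∀ j ∈ F, ∀ k ∈ F, j ≠ k → d ≤ |s j - s k| := by
  set D : ℝ := 1 + ∑ p ∈ F ×ˢ F, |s p.1 - s p.2|⁻¹ with hD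
  have h0 : 0 ≤ ∑ p ∈ F ×ˢ F, |s p.1 - s p.2|⁻¹ := Finset.sum_nonneg fun p _ => by positivity
  have hD1 : 1 ≤ D := by linarith
  refine ⟨D⁻¹, by positivity, inv_le_one_of_one_le₀ hD1, fun j hj k hk hjk => ?_⟩
  have h1 : |s j - s k|⁻¹ ≤ ∑ p ∈ F ×ˢ F, |s p.1 - s p.2|⁻¹ :=
    Finset.single_le_sum (f := fun p : ℕ × ℕ => |s p.1 - s p.2|⁻¹) (fun p _ => by positivity)
      (Finset.mk_mem_product hj hk)
  have h2 : 0 < |s j - s k| := abs_pos.2 (sub_ne_zero.2 fun h => hjk (hs hj hk h))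
  rw [inv_le_comm₀ (by positivity) h2]
  linarith

lemma integrand_eq (α β C T : ℝ) (m l : ℕ) (u : ℝ) (z : ℂ) :
    integrand α β C T m l u z = ((1 / (2 * Real.sqrt u) : ℝ) : ℂ) *
      integrandSqrt α C T (node β m) m l z (Real.sqrt u) := by
  rw [integrand, integrandSqrt, expScale_ofReal, div_eq_inv_mul (Real.sqrt u - T) α,
    ← one_div α]
  simp only [ofReal_mul, ofReal_pow, ofReal_sub, ofReal_exp, ofReal_add, ofReal_div, ofReal_one,
    ofReal_ofNat, mul_assoc]

lemma continuous_integrandSqrt_ofReal {α C T θ : ℝ} {s : ℕ → ℝ} {m l : ℕ} {z : ℂ}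
    (hC : 0 < C) (hθ0 : 0 ≤ θ) (hθ : θ < Real.pi) (hz : |z.arg| ≤ θ)
    (hs : ∀ k ∈ Finset.Icc 1 m, 1 < s k ∧ s k ≤ 5) :
    Continuous fun x : ℝ => integrandSqrt α C T s m l z x := by
  rw [continuous_iff_continuousAt]
  intro x
  have hq : 0 < C * Real.exp ((x - T) / α) := by positivity
  refine ContinuousAt.comp (g := integrandSqrt α C T s m l z) (DifferentiableAt.continuousAt
    (differentiableAt_integrandSqrt ?_ fun k hk => ?_)) continuous_ofReal.continuousAt
  · rw [expScale_ofReal]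
    have h1 := norm_ofReal_add_ge hq.le hθ.le hz
    have h2 := sectorConst_pos hθ0 hθ
    exact norm_pos_iff.1 ((mul_pos h2 (by positivity)).trans_le h1)
  · rw [expScale_ofReal, ← ofReal_add]
    exact_mod_cast (add_pos hq (zero_lt_one.trans (hs k hk).1)).ne'

lemma intervalIntegrable_integrand {α β C T : ℝ} {m l : ℕ} {z : ℂ} (hβ₀ : 0 ≤ β) (hβ₂ : β < 2)
    (hC : 0 < C) (hz : z ∈ sector β) {A : ℝ} (hA : 0 ≤ A) :
    IntervalIntegrable (fun u => integrand α β C T m l u z) volume 0 A := by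
  have hpi := Real.pi_pos
  have hcont : Continuous fun x : ℝ => integrandSqrt α C T (node β m) m l z x :=
    continuous_integrandSqrt_ofReal hC (θ := β * Real.pi / 2) (by positivity) (by nlinarith)
      (sector_spec hβ₂ hz).2 fun k hk => node_bounds hk
  have h1 : IntervalIntegrable (fun u : ℝ => ((1 / (2 * Real.sqrt u) : ℝ) : ℂ)) volume 0 A := by
    have h2 := (intervalIntegral.intervalIntegrable_rpow' (a := 0) (b := A)
      (r := -(1 / 2)) (by norm_num)).const_mul (1 / 2)
    have h3 : IntervalIntegrable (fun u : ℝ => 1 / (2 * Real.sqrt u)) volume 0 A := by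
      refine h2.congr fun u hu => ?_
      rw [uIoc_of_le hA] at hu
      rw [Real.rpow_neg hu.1.le, ← Real.sqrt_eq_rpow, one_div, one_div, mul_inv]
    rw [intervalIntegrable_iff] at h3 ⊢
    exact h3.ofReal
  have h4 := h1.mul_continuousOn (hcont.comp Real.continuous_sqrt).continuousOn
  simp only [integrand_eq]
  exact h4

lemma integral_integrand {α β C T : ℝ} {m l : ℕ} {z : ℂ} (hβ₀ : 0 ≤ β) (hβ₂ : β < 2)
    (hC : 0 < C) (hz : z ∈ sector β) {A : ℝ} (hA : 0 ≤ A) :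
    ∫ u in (0 : ℝ)..A, integrand α β C T m l u z =
      ∫ x in (0 : ℝ)..Real.sqrt A, integrandSqrt α C T (node β m) m l z x := by
  have hpi := Real.pi_pos
  have hcont : Continuous fun x : ℝ => integrandSqrt α C T (node β m) m l z x :=
    continuous_integrandSqrt_ofReal hC (θ := β * Real.pi / 2) (by positivity) (by nlinarith)
      (sector_spec hβ₂ hz).2 fun k hk => node_bounds hk
  have h := intervalIntegral.integral_deriv_smul_comp''' (a := 0) (b := A) (f := Real.sqrt)
    (f' := fun u => 1 / (2 * Real.sqrt u))
    (g := fun x : ℝ => integrandSqrt α C T (node β m) m l z x)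
    Real.continuous_sqrt.continuousOn (fun u hu => by
      rw [min_eq_left hA] at hu
      exact (Real.hasDerivAt_sqrt hu.1.ne').hasDerivWithinAt)
    hcont.continuousOn (hcont.continuousOn.integrableOn_compact
      (isCompact_uIcc.image Real.continuous_sqrt))
    (by
      have h1 := intervalIntegrable_integrand (α := α) (T := T) (m := m) (l := l) hβ₀ hβ₂ hC hz hA
      rw [intervalIntegrable_iff', uIcc_of_le hA] at h1
      rw [uIcc_of_le hA]
      refine h1.congr_fun (fun u _ => ?_) measurableSet_Icc
      simp only [integrand_eq, Function.comp, real_smul])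
  rw [Real.sqrt_zero] at h
  rw [← h]
  refine intervalIntegral.integral_congr fun u _ => ?_
  simp only [integrand_eq, Function.comp, real_smul]

/-! ### The contour estimate for the integrand -/

/-- The contour estimate. The number `B` controls the residues at the poles and `J` the integrals
over the two horizontal sides `Im w = ± 2 π α`, on which `X(w)` is positive, so that the integrand
has the same bounds there as on the real axis. -/
theorem norm_quadrature_error_le {α C T θ h r R κ d c M S B J ρ : ℝ} {s : ℕ → ℝ} {m l n : ℕ}
    {z : ℂ} (hα : 0 < α) (hC : 0 < C) (hθ0 : 0 ≤ θ) (hθ : θ < Real.pi) (hz0 : z ≠ 0)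
    (hz : ‖z‖ ≤ 1) (hza : |z.arg| ≤ θ) (hκ : 1 / κ = (m + 1) / α - 1)
    (hs : ∀ k ∈ Finset.Icc 1 m, 1 < s k ∧ s k ≤ 5) (hd : 0 < d) (hd1 : d ≤ 1)
    (hsd : ∀ j ∈ Finset.Icc 1 m, ∀ k ∈ Finset.Icc 1 m, j ≠ k → d ≤ |s j - s k|)
    (hh : 0 < h) (hρ : 0 < ρ) (hρr : ρ ≤ r) (hrh : r ^ 2 < h) (hrR : r ≤ R)
    (hR : R ^ 2 = (n + 1 / 2) * h) (hc : 0 < c) (hcθ : c ≤ sectorConst θ)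
    (hsep : ∀ x : ℝ, x = r ∨ x = R → ∀ w : ℂ, w.re = x →
      c * (‖expScale α C T w‖ + ‖z‖) ≤ ‖expScale α C T w + z‖ ∧
      ∀ k ∈ Finset.Icc 1 m, c * (‖expScale α C T w‖ + s k) ≤ ‖expScale α C T w + s k‖)
    (hM : ∀ x : ℝ, x = r ∨ x = R → ∀ y : ℝ,
      (y ∈ Icc 0 (2 * Real.pi * α) → ‖kernel h (x + y * I)‖ ≤ M) ∧
      (y ∈ Icc (-(2 * Real.pi * α)) 0 → ‖kernel h (x + y * I) - 1‖ ≤ M))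
    (hS : ∀ x : ℝ, x = r ∨ x = R → ∀ y ∈ Icc (-(2 * Real.pi * α)) (2 * Real.pi * α),
      ‖integrandSqrt α C T s m l z (x + y * I)‖ ≤ S)
    (hB0 : 0 ≤ B)
    (hB : ∀ τ : ℝ, -T < τ → τ ≤ α * Real.log (5 / C) →
      (|τ| + 2 * Real.pi * α) ^ l *
        Real.exp (τ - 4 * Real.pi * (α * (Real.pi - θ)) / h * (τ + T)) ≤ B)
    (hJ : ∫ x in r..R, (|x - T| + 2 * Real.pi * α) ^ l *
      min (Real.exp (x - T)) (Real.exp (-((x - T) / κ))) *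
      Real.exp (-(2 * (4 * Real.pi * (α * (Real.pi - θ)) / h) * x)) ≤ J) :
    ‖(∫ x : ℝ in r..R, integrandSqrt α C T s m l z x) -
        ∑ j ∈ Finset.Icc 1 n, h / (2 * (Real.sqrt (j * h) : ℂ)) *
          integrandSqrt α C T s m l z (Real.sqrt (j * h))‖ ≤
      2 * Real.pi * ((2 * (m + 1)) * (α * C ^ α * (6 / d) ^ m *
        (1 - Real.exp (-(4 * Real.pi * ρ * (α * (Real.pi - θ)) / h)))⁻¹ * B)) +
      2 * (C ^ α * (1 / c) * (6 / c) ^ m * max 1 ((C ^ (m + 1))⁻¹) *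
        (1 - Real.exp (-(4 * Real.pi * ρ * (2 * Real.pi * α) / h)))⁻¹ * J) +
      4 * (S * M * (2 * Real.pi * α)) := by
  classical
  have hpi := Real.pi_pos
  set b : ℝ := 2 * Real.pi * α with hb
  set a : ℝ := α * (Real.pi - θ) with ha
  set G : ℂ → ℂ := integrandSqrt α C T s m l z with hGdef
  have hb0 : 0 < b := by positivity
  have ha0 : 0 < a := mul_pos hα (by linarith)
  have hr0 : 0 < r := hρ.trans_le hρr
  have hCa : 0 < C ^ α := Real.rpow_pos_of_pos hC α
  set Y : Finset ℂ := insert z ((Finset.Icc 1 m).image fun k => (s k : ℂ)) with hY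
  have hYmem : ∀ y ∈ Y, y = z ∨ ∃ k ∈ Finset.Icc 1 m, y = s k := by
    intro y hy
    rcases Finset.mem_insert.1 hy with h1 | h1
    · exact Or.inl h1
    · obtain ⟨k, hk, rfl⟩ := Finset.mem_image.1 h1
      exact Or.inr ⟨k, hk, rfl⟩
  have hYspec : ∀ y ∈ Y, y ≠ 0 ∧ |y.arg| ≤ θ ∧ ‖y‖ ≤ 5 := by
    intro y hy
    rcases hYmem y hy with rfl | ⟨k, hk, rfl⟩
    · exact ⟨hz0, hza, by linarith⟩
    · obtain ⟨h1, h5⟩ := hs k hk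
      have h0 : 0 < s k := by linarith
      refine ⟨by exact_mod_cast h0.ne', ?_, ?_⟩
      · rw [Complex.arg_ofReal_of_nonneg h0.le, abs_zero]; exact hθ0
      · rw [Complex.norm_real, Real.norm_of_nonneg h0.le]; exact h5
  set P : Finset ℂ := ((Y ×ˢ ({1, -1} : Finset ℝ)).image
    fun q => polePoint α C T q.1 q.2).filter fun p => p.re ∈ Ioo r R with hP
  have hcard : (P.card : ℝ) ≤ 2 * (m + 1) := by
    have h1 : P.card ≤ (m + 1) * 2 := by
      refine (Finset.card_filter_le _ _).trans (Finset.card_image_le.trans ?_)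
      rw [Finset.card_product]
      refine Nat.mul_le_mul ((Finset.card_insert_le _ _).trans ?_) Finset.card_le_two
      have := Finset.card_image_le (s := Finset.Icc 1 m) (f := fun k => (s k : ℂ))
      simp only [Nat.card_Icc, Nat.add_sub_cancel] at this
      omega
    have h2 : (P.card : ℝ) ≤ ((m + 1) * 2 : ℕ) := by exact_mod_cast h1
    push_cast at h2
    linarith
  have hPmem : ∀ p ∈ P, p.re ∈ Ioo r R ∧ a ≤ |p.im| ∧ |p.im| < b ∧
      ∃ y ∈ Y, expScale α C T p = -y := by
    intro p hp
    rw [hP, Finset.mem_filter] at hp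
    obtain ⟨⟨y, ε⟩, hyε, rfl⟩ := Finset.mem_image.1 hp.1
    obtain ⟨hy, hε⟩ := Finset.mem_product.1 hyε
    have hε' : ε = 1 ∨ ε = -1 := by simpa using hε
    obtain ⟨h1, h2, -⟩ := hYspec y hy
    obtain ⟨h3, h4⟩ := polePoint_im_bounds (T := T) hα hC hθ h2 hε'
    exact ⟨hp.2, h3, h4, y, hy, expScale_polePoint hα hC h1 hε'⟩
  have hsepY : ∀ x : ℝ, x = r ∨ x = R → ∀ w : ℂ, w.re = x → ∀ y ∈ Y,
      expScale α C T w + y ≠ 0 := by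
    intro x hx w hw y hy h0
    obtain ⟨h1, h2⟩ := hsep x hx w hw
    have hX : 0 < ‖expScale α C T w‖ := by rw [norm_expScale hC]; positivity
    rcases hYmem y hy with rfl | ⟨k, hk, rfl⟩
    · rw [h0, norm_zero] at h1
      have : 0 < c * (‖expScale α C T w‖ + ‖y‖) := by positivity
      linarith
    · have h3 := h2 k hk
      rw [h0, norm_zero] at h3
      have hsk := zero_lt_one.trans (hs k hk).1
      have : 0 < c * (‖expScale α C T w‖ + s k) := by positivity
      linarith
  have hPcompl : ∀ w : ℂ, w.re ∈ Icc r R → w.im ∈ Icc (-b) b → w ∉ P → ∀ y ∈ Y,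
      expScale α C T w + y ≠ 0 := by
    intro w hre him hw y hy h0
    obtain ⟨h1, h2, -⟩ := hYspec y hy
    have hre' : w.re ∈ Ioo r R := by
      refine ⟨lt_of_le_of_ne hre.1 fun he => ?_, lt_of_le_of_ne hre.2 fun he => ?_⟩
      · exact hsepY r (Or.inl rfl) w he.symm y hy h0
      · exact hsepY R (Or.inr rfl) w he y hy h0
    refine hw (Finset.mem_filter.2 ⟨?_, hre'⟩)
    rcases eq_polePoint hα hC h1 (h2.trans_lt hθ) (abs_le.2 him)
      (eq_neg_of_add_eq_zero_left h0) with h3 | h3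
    · exact Finset.mem_image.2 ⟨(y, 1), Finset.mem_product.2 ⟨hy, by simp⟩, h3.symm⟩
    · exact Finset.mem_image.2 ⟨(y, -1), Finset.mem_product.2 ⟨hy, by simp⟩, h3.symm⟩
  have hzY : z ∈ Y := Finset.mem_insert_self _ _
  have hsY : ∀ k ∈ Finset.Icc 1 m, (s k : ℂ) ∈ Y := fun k hk =>
    Finset.mem_insert_of_mem (Finset.mem_image_of_mem _ hk)
  have hG : ∀ w : ℂ, w.re ∈ Icc r R → w.im ∈ Icc (-b) b → w ∉ P → DifferentiableAt ℂ G w :=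
    fun w h1 h2 h3 => differentiableAt_integrandSqrt (hPcompl w h1 h2 h3 z hzY)
      fun k hk => hPcompl w h1 h2 h3 _ (hsY k hk)
  have hres : ∀ p ∈ P, ∃ c : ℂ, Tendsto (fun w => (w - p) * G w) (𝓝[≠] p) (𝓝 c) ∧
      ‖c‖ ≤ α * C ^ α * (6 / d) ^ m * (‖p - T‖ ^ l * Real.exp (p.re - T)) := by
    intro p hp
    obtain ⟨-, -, -, y, hy, hpy⟩ := hPmem p hp
    rcases hYmem y hy with rfl | ⟨k, hk, rfl⟩
    · exact exists_residue_left hα hC hd hd1 hz0 hz hs hpy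
    · exact exists_residue_node hα hC hd hd1 hz hs hsd hk hpy
  choose! res hres1 hres2 using hres
  have hBp : ∀ p ∈ P, ‖res p‖ * ‖if 0 < p.im then kernel h p else kernel h p - 1‖ ≤
      α * C ^ α * (6 / d) ^ m * (1 - Real.exp (-(4 * Real.pi * ρ * a / h)))⁻¹ * B := by
    intro p hp
    obtain ⟨hre, him1, him2, y, hy, hpy⟩ := hPmem p hp
    have hk : ‖if 0 < p.im then kernel h p else kernel h p - 1‖ ≤
        (1 - Real.exp (-(4 * Real.pi * ρ * a / h)))⁻¹ *
          Real.exp (-(4 * Real.pi * p.re * a / h)) := by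
      split_ifs with h0
      · rw [abs_of_pos h0] at him1
        exact norm_kernel_le hh hρ ha0 (hρr.trans hre.1.le) him1
      · rw [abs_of_nonpos (not_lt.1 h0)] at him1
        exact norm_kernel_sub_one_le hh hρ ha0 (hρr.trans hre.1.le) (by linarith)
    have hτ1 : -T < p.re - T := by linarith [hre.1]
    have hτ2 : p.re - T ≤ α * Real.log (5 / C) := by
      have h1 := norm_expScale (α := α) hC T p
      rw [hpy, norm_neg] at h1
      have h2 : Real.exp ((p.re - T) / α) ≤ 5 / C := by
        rw [le_div_iff₀ hC]
        linarith [(hYspec y hy).2.2]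
      rw [← Real.le_log_iff_exp_le (by positivity), div_le_iff₀ hα] at h2
      linarith
    have hnorm : ‖p - T‖ ≤ |p.re - T| + b := by
      refine (Complex.norm_le_abs_re_add_abs_im _).trans ?_
      simp only [sub_re, ofReal_re, sub_im, ofReal_im, sub_zero]
      linarith
    have hk1 : 0 < (1 - Real.exp (-(4 * Real.pi * ρ * a / h)))⁻¹ := by
      refine inv_pos.2 (sub_pos.2 (Real.exp_lt_one_iff.2 ?_))
      have : 0 < 4 * Real.pi * ρ * a / h := by positivity
      linarith
    calc _ ≤ (α * C ^ α * (6 / d) ^ m * (‖p - T‖ ^ l * Real.exp (p.re - T))) *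
          ((1 - Real.exp (-(4 * Real.pi * ρ * a / h)))⁻¹ *
          Real.exp (-(4 * Real.pi * p.re * a / h))) := by
          have := hres2 p hp
          gcongr
      _ ≤ (α * C ^ α * (6 / d) ^ m * ((|p.re - T| + b) ^ l * Real.exp (p.re - T))) *
          ((1 - Real.exp (-(4 * Real.pi * ρ * a / h)))⁻¹ *
          Real.exp (-(4 * Real.pi * p.re * a / h))) := by gcongr
      _ = α * C ^ α * (6 / d) ^ m * (1 - Real.exp (-(4 * Real.pi * ρ * a / h)))⁻¹ *
          ((|p.re - T| + b) ^ l *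
            Real.exp (p.re - T - 4 * Real.pi * a / h * (p.re - T + T))) := by
          rw [sub_eq_add_neg (p.re - T) (4 * Real.pi * a / h * (p.re - T + T)), Real.exp_add]
          rw [show -(4 * Real.pi * a / h * (p.re - T + T)) = -(4 * Real.pi * p.re * a / h) by ring]
          ring
      _ ≤ _ := by
          have := hB _ hτ1 hτ2
          gcongr
  set M1 := C ^ α * (1 / c) * (6 / c) ^ m * max 1 ((C ^ (m + 1))⁻¹) with hM1
  have hM10 : 0 < M1 := by positivity
  set k0 := (1 - Real.exp (-(4 * Real.pi * ρ * b / h)))⁻¹ with hk0def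
  have hk0 : 0 < k0 := by
    refine inv_pos.2 (sub_pos.2 (Real.exp_lt_one_iff.2 ?_))
    have : 0 < 4 * Real.pi * ρ * b / h := by positivity
    linarith
  set g : ℝ → ℝ := fun x => M1 * k0 * ((|x - T| + b) ^ l *
      min (Real.exp (x - T)) (Real.exp (-((x - T) / κ))) *
      Real.exp (-(2 * (4 * Real.pi * a / h) * x))) with hg
  have hgc : Continuous g := by simp only [hg]; fun_prop
  have hline : ∀ x : ℝ, ∀ y : ℝ, |y| ≤ b →
      expScale α C T (x + y * I) = (C * Real.exp ((x - T) / α) : ℝ) →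
      ‖G (x + y * I)‖ ≤ M1 * ((|x - T| + b) ^ l *
        min (Real.exp (x - T)) (Real.exp (-((x - T) / κ)))) := by
    intro x y hy hX
    have hq : 0 ≤ C * Real.exp ((x - T) / α) := by positivity
    have hXY : ∀ v ∈ Y, c * (‖expScale α C T (x + y * I)‖ + ‖v‖) ≤
        ‖expScale α C T (x + y * I) + v‖ := by
      intro v hv
      rw [hX, Complex.norm_real, Real.norm_of_nonneg hq]
      refine le_trans ?_ (norm_ofReal_add_ge hq hθ.le (hYspec v hv).2.1)
      gcongr
    have h1 := norm_integrandSqrt_le (l := l) hC hκ hc hz hs (hXY z hzY) (fun k hk => by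
      have := hXY _ (hsY k hk)
      rwa [Complex.norm_real, Real.norm_of_nonneg (zero_lt_one.trans (hs k hk).1).le] at this)
    have h2 : ‖(x + y * I : ℂ) - T‖ ≤ |x - T| + b := by
      refine (Complex.norm_le_abs_re_add_abs_im _).trans ?_
      simpa using hy
    have h3 : (x + y * I : ℂ).re = x := by simp
    rw [h3] at h1
    refine h1.trans ?_
    gcongr
  have hexp : ∀ x : ℝ, 0 ≤ x → Real.exp (-(4 * Real.pi * x * b / h)) ≤
      Real.exp (-(2 * (4 * Real.pi * a / h) * x)) := by
    intro x hx
    rw [Real.exp_le_exp, neg_le_neg_iff]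
    have hab : 2 * a ≤ b := by
      rw [ha, hb]; nlinarith
    rw [show 2 * (4 * Real.pi * a / h) * x = 4 * Real.pi * x * (2 * a) / h by ring]
    gcongr
  have hgu : ∀ x ∈ Icc r R, ‖G (x + b * I) * kernel h (x + b * I)‖ ≤ g x := by
    intro x hx
    have h1 := hline x b (abs_of_pos hb0).le (expScale_add_period hα C T x)
    have h2 := norm_kernel_le hh hρ hb0 (w := x + b * I) (by simpa using hρr.trans hx.1)
      (by simp)
    have h3 := hexp x (hr0.le.trans hx.1)
    have h4 : (x + b * I : ℂ).re = x := by simp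
    rw [h4] at h2
    rw [norm_mul]
    calc _ ≤ M1 * ((|x - T| + b) ^ l *
        min (Real.exp (x - T)) (Real.exp (-((x - T) / κ)))) *
          (k0 * Real.exp (-(2 * (4 * Real.pi * a / h) * x))) := by
          refine mul_le_mul h1 (h2.trans ?_) (norm_nonneg _) (by positivity)
          gcongr
      _ = g x := by simp only [hg]; ring
  have hgl : ∀ x ∈ Icc r R,
      ‖G (x + (-b : ℝ) * I) * (kernel h (x + (-b : ℝ) * I) - 1)‖ ≤ g x := by
    intro x hx
    have h1 := hline x (-b) (by rw [abs_neg, abs_of_pos hb0]) (expScale_sub_period hα C T x)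
    have h2 := norm_kernel_sub_one_le hh hρ hb0 (w := x + (-b : ℝ) * I)
      (by simpa using hρr.trans hx.1) (by simp)
    have h3 := hexp x (hr0.le.trans hx.1)
    have h4 : (x + (-b : ℝ) * I : ℂ).re = x := by simp
    rw [h4] at h2
    rw [norm_mul]
    calc _ ≤ M1 * ((|x - T| + b) ^ l *
        min (Real.exp (x - T)) (Real.exp (-((x - T) / κ)))) *
          (k0 * Real.exp (-(2 * (4 * Real.pi * a / h) * x))) := by
          refine mul_le_mul h1 (h2.trans ?_) (norm_nonneg _) (by positivity)
          gcongr
      _ = g x := by simp only [hg]; ring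
  have hmain := quadrature_error_le hh hr0 hrh hrR hR hb0 P
    (fun p hp => by
      obtain ⟨h1, h2, h3, -⟩ := hPmem p hp
      exact ⟨h1, abs_lt.1 h3, abs_pos.1 (ha0.trans_le h2)⟩)
    hG res hres1 hBp hM hS hgc hgu hgl
  refine hmain.trans ?_
  have hgint : ∫ x in r..R, g x ≤ M1 * k0 * J := by
    simp only [hg]
    rw [intervalIntegral.integral_const_mul]
    exact mul_le_mul_of_nonneg_left hJ (by positivity)
  have hk1 : 0 < (1 - Real.exp (-(4 * Real.pi * ρ * a / h)))⁻¹ := by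
    refine inv_pos.2 (sub_pos.2 (Real.exp_lt_one_iff.2 ?_))
    have : 0 < 4 * Real.pi * ρ * a / h := by positivity
    linarith
  gcongr

/-! ### Choice of the contour -/

lemma step_pos {α σ : ℝ} (hα : 0 < α) (hσ : 0 < σ) : 0 < step α σ := by
  unfold step; positivity

lemma trunc_sq (α σ : ℝ) (N : ℕ) : trunc α σ N ^ 2 = N * step α σ := by
  rw [trunc, mul_pow, Real.sq_sqrt (Nat.cast_nonneg N), step]; ring

lemma kappa_pos {α : ℝ} {m : ℕ} (hα : 0 < α) (hm : α < m + 1) : 0 < kappa α m :=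
  div_pos hα (by linarith)

lemma one_div_kappa {α : ℝ} {m : ℕ} (hα : 0 < α) :
    1 / kappa α m = (m + 1) / α - 1 := by
  rw [kappa, one_div_div, sub_div, div_self hα.ne']

lemma eta_sq {α β σ : ℝ} (hα : 0 < α) (hβ₂ : β < 2) (hσ : 0 < σ) :
    4 * Real.pi * (α * (Real.pi - β * Real.pi / 2)) / step α σ = eta α β σ ^ 2 := by
  rw [eta, sigmaOpt, step, div_pow, div_pow, mul_pow, Real.sq_sqrt (by linarith),
    Real.sq_sqrt hα.le]
  field_simp
  ring

lemma numPoints_bounds {α σ : ℝ} {m N : ℕ} (hα : 0 < α) (hσ : 0 < σ) :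
    ((kappa α m + 1) * trunc α σ N) ^ 2 ≤ numPoints α m N * step α σ ∧
      numPoints α m N * step α σ ≤ ((kappa α m + 1) * trunc α σ N) ^ 2 + step α σ := by
  have hh := step_pos hα hσ
  have h1 := Nat.le_ceil ((kappa α m + 1) ^ 2 * (N : ℝ))
  have h2 := (Nat.ceil_lt_add_one
    (by positivity : 0 ≤ (kappa α m + 1) ^ 2 * (N : ℝ))).le
  rw [mul_pow, trunc_sq, numPoints]
  constructor <;> nlinarith

lemma quadError_eq {α β σ C : ℝ} {m l N : ℕ} {z : ℂ} (hα : 0 < α) (hβ₀ : 0 ≤ β) (hβ₂ : β < 2)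
    (hσ : 0 < σ) (hC : 0 < C) (hz : z ∈ sector β) :
    quadError α β σ C m l N z =
      (∫ x in (0 : ℝ)..Real.sqrt (numPoints α m N * step α σ),
        integrandSqrt α C (trunc α σ N) (node β m) m l z x) -
      ∑ j ∈ Finset.Icc 1 (numPoints α m N),
        step α σ / (2 * (Real.sqrt (j * step α σ) : ℂ)) *
          integrandSqrt α C (trunc α σ N) (node β m) m l z (Real.sqrt (j * step α σ)) := by
  have hh := step_pos hα hσ
  rw [quadError, integral_integrand hβ₀ hβ₂ hC hz (by positivity), Finset.mul_sum]
  congr 1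
  refine Finset.sum_congr rfl fun j _ => ?_
  rw [integrand_eq]
  push_cast
  ring

set_option maxHeartbeats 1000000 in
/-- Reduction of the error estimate to two bounds: `B` for the residues, `J` for the integrals
along the horizontal sides. -/
theorem exists_norm_quadError_le {α β σ C : ℝ} {m l : ℕ} (hα : 0 < α) (hβ₀ : 0 ≤ β)
    (hβ₂ : β < 2) (hσ : 0 < σ) (hC : 0 < C) (hm : α < m + 1) :
    ∃ K T₀ : ℝ, 0 < K ∧ 1 ≤ T₀ ∧ ∀ N : ℕ, T₀ ≤ trunc α σ N → ∀ z ∈ sector β, ∀ B J : ℝ, 0 ≤ B →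
      (∀ τ : ℝ, -trunc α σ N < τ → τ ≤ α * Real.log (5 / C) →
        (|τ| + 2 * Real.pi * α) ^ l *
          Real.exp (τ - eta α β σ ^ 2 * (τ + trunc α σ N)) ≤ B) →
      (∀ r R : ℝ, 0 < r → r ≤ R →
        ∫ x in r..R, (|x - trunc α σ N| + 2 * Real.pi * α) ^ l *
          min (Real.exp (x - trunc α σ N)) (Real.exp (-((x - trunc α σ N) / kappa α m))) *
          Real.exp (-(2 * eta α β σ ^ 2 * x)) ≤ J) →
      ‖quadError α β σ C m l N z‖ ≤
        K * (trunc α σ N ^ l * Real.exp (-trunc α σ N) + B + J) := by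
  have hpi := Real.pi_pos
  set h := step α σ with hhdef
  have hh : 0 < h := step_pos hα hσ
  set κ := kappa α m with hκdef
  have hκ : 0 < κ := kappa_pos hα hm
  have hκ' : 1 / κ = (m + 1) / α - 1 := one_div_kappa hα
  set b := 2 * Real.pi * α with hb
  have hb0 : 0 < b := by positivity
  set θ := β * Real.pi / 2 with hθdef
  have hθ0 : 0 ≤ θ := by positivity
  have hθ : θ < Real.pi := by nlinarith
  obtain ⟨d, hd, hd1, hsd⟩ := exists_separation _ (node_injOn β m)
  -- two candidates for the left side of the contour, and half-integer `R² / h` on the right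
  set r₁ := Real.sqrt (h / 3) with hr₁
  set r₂ := Real.sqrt (2 * h / 3) with hr₂
  have hr₁sq : r₁ ^ 2 = h / 3 := Real.sq_sqrt (by positivity)
  have hr₂sq : r₂ ^ 2 = 2 * h / 3 := Real.sq_sqrt (by positivity)
  have hr₁0 : 0 < r₁ := Real.sqrt_pos.2 (by positivity)
  have hr₁₂ : r₁ < r₂ := Real.sqrt_lt_sqrt (by positivity) (by linarith)
  obtain ⟨M₁, hM₁0, hM₁⟩ := exists_norm_kernel_le (ν := 1 / 3) hh hr₁0 hb0 (by
    intro k hk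
    have : (3 * k : ℝ) = 1 := by linarith
    have : (3 * k : ℤ) = 1 := by exact_mod_cast this
    omega)
  obtain ⟨M₂, hM₂0, hM₂⟩ := exists_norm_kernel_le (ν := 2 / 3) hh hr₁0 hb0 (by
    intro k hk
    have : (3 * k : ℝ) = 2 := by linarith
    have : (3 * k : ℤ) = 2 := by exact_mod_cast this
    omega)
  obtain ⟨M₃, hM₃0, hM₃⟩ := exists_norm_kernel_le (ν := 1 / 2) hh hr₁0 hb0 (by
    intro k hk
    have : (2 * k : ℝ) = 1 := by linarith
    have : (2 * k : ℤ) = 1 := by exact_mod_cast this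
    omega)
  set M := M₁ + M₂ + M₃ with hMdef
  have hM0 : 0 < M := by positivity
  -- the ratio of `|X|` on the two candidate sides is `(1 + μ)²`
  set μ := Real.exp ((r₂ - r₁) / (2 * α)) - 1 with hμdef
  have hμ : 0 < μ := by
    have : 0 < (r₂ - r₁) / (2 * α) := div_pos (by linarith) (by positivity)
    linarith [Real.add_one_lt_exp this.ne']
  have hμ2 : (1 + μ) * (1 + μ) = Real.exp ((r₂ - r₁) / α) := by
    rw [hμdef, add_sub_cancel, ← Real.exp_add]
    congr 1
    field_simp
    ring
  set c := min (sectorConst θ) (μ / (2 + μ)) with hcdef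
  have hc : 0 < c := lt_min (sectorConst_pos hθ0 hθ) (by positivity)
  set M1 := C ^ α * (1 / c) * (6 / c) ^ m * max 1 ((C ^ (m + 1))⁻¹) with hM1
  have hCa : 0 < C ^ α := Real.rpow_pos_of_pos hC α
  have hM10 : 0 < M1 := by positivity
  set H := Real.sqrt h with hH
  have hH0 : 0 < H := Real.sqrt_pos.2 hh
  have hHsq : H ^ 2 = h := Real.sq_sqrt hh.le
  have hr₂H : r₂ < H := Real.sqrt_lt_sqrt (by positivity) (by linarith)
  set D := κ + 1 + 2 * H + b with hD
  have hD0 : 0 < D := by positivity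
  set k1 := (1 - Real.exp (-(4 * Real.pi * r₁ * (α * (Real.pi - θ)) / h)))⁻¹ with hk1
  have hk10 : 0 < k1 := by
    refine inv_pos.2 (sub_pos.2 (Real.exp_lt_one_iff.2 ?_))
    have h1 : 0 < α * (Real.pi - θ) := mul_pos hα (by linarith)
    have : 0 < 4 * Real.pi * r₁ * (α * (Real.pi - θ)) / h := by positivity
    linarith
  set k0 := (1 - Real.exp (-(4 * Real.pi * r₁ * b / h)))⁻¹ with hk0
  have hk00 : 0 < k0 := by
    refine inv_pos.2 (sub_pos.2 (Real.exp_lt_one_iff.2 ?_))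
    have : 0 < 4 * Real.pi * r₁ * b / h := by positivity
    linarith
  set KB := 2 * Real.pi * ((2 * (m + 1)) * (α * C ^ α * (6 / d) ^ m * k1)) with hKB
  set KJ := 2 * (M1 * k0) with hKJ
  set S₀ := M1 * (Real.exp H * D ^ l) with hS₀
  set KS := 4 * (S₀ * M * b) + 3 * H * S₀ with hKS
  have hKB0 : 0 < KB := by positivity
  have hKJ0 : 0 < KJ := by positivity
  have hS₀0 : 0 < S₀ := by positivity
  have hKS0 : 0 < KS := by positivity
  -- for large `T` the poles of the nodes lie well inside the contour
  have hT1 : ∀ᶠ T : ℝ in atTop, (1 + μ) * (C * Real.exp ((H - T) / α)) ≤ 1 := by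
    have h1 : Tendsto (fun T : ℝ => (H - T) / α) atTop atBot :=
      (tendsto_atBot_add_const_left _ H tendsto_neg_atTop_atBot).atBot_div_const hα
    have h2 := ((Real.tendsto_exp_atBot.comp h1).const_mul C).const_mul (1 + μ)
    simp only [mul_zero] at h2
    exact h2.eventually_le_const one_pos
  have hT2 : ∀ᶠ T : ℝ in atTop, (1 + μ) * 5 ≤ C * Real.exp (κ * T / α) := by
    have h1 : Tendsto (fun T : ℝ => κ * T / α) atTop atTop :=
      (tendsto_id.const_mul_atTop hκ).atTop_div_const hα
    have h2 := (Real.tendsto_exp_atTop.comp h1).const_mul_atTop hC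
    exact h2.eventually_ge_atTop _
  obtain ⟨T₁, hT₁⟩ := eventually_atTop.1 (hT1.and hT2)
  refine ⟨KB + KJ + KS, max T₁ (max 1 H), by positivity,
    (le_max_left _ _).trans (le_max_right _ _), ?_⟩
  intro N hN z hzs B J hB0 hB hJ
  set T := trunc α σ N with hTdef
  obtain ⟨hTa, hTb⟩ := hT₁ T ((le_max_left _ _).trans hN)
  have hT1 : 1 ≤ T := ((le_max_left _ _).trans (le_max_right _ _)).trans hN
  have hTH : H ≤ T := ((le_max_right _ _).trans (le_max_right _ _)).trans hN
  have hT0 : 0 < T := zero_lt_one.trans_le hT1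
  have hJ0 : 0 ≤ J := by simpa using hJ 1 1 one_pos le_rfl
  obtain ⟨hz, hza⟩ := sector_spec hβ₂ hzs
  rw [quadError_eq hα hβ₀ hβ₂ hσ hC hzs, ← hhdef, ← hTdef]
  set n := numPoints α m N with hn
  obtain ⟨hn1, hn2⟩ := numPoints_bounds (N := N) (m := m) hα hσ
  rw [← hhdef, ← hTdef, ← hκdef, ← hn] at hn1 hn2
  rcases eq_or_ne z 0 with rfl | hz0
  · have h0 : ∀ w, integrandSqrt α C T (node β m) m l 0 w = 0 := fun w => by
      simp [integrandSqrt]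
    simp only [h0, mul_zero, Finset.sum_const_zero, intervalIntegral.integral_zero, sub_zero,
      norm_zero]
    positivity
  set G : ℂ → ℂ := integrandSqrt α C T (node β m) m l z with hG
  set A := Real.sqrt (n * h) with hA
  set R := Real.sqrt ((n + 1 / 2) * h) with hRdef
  have hAsq : A ^ 2 = n * h := Real.sq_sqrt (by positivity)
  have hRsq : R ^ 2 = (n + 1 / 2) * h := Real.sq_sqrt (by positivity)
  have hA0 : 0 ≤ A := Real.sqrt_nonneg _
  have hR0 : 0 ≤ R := Real.sqrt_nonneg _
  have hAR : A ≤ R := Real.sqrt_le_sqrt (mul_le_mul_of_nonneg_right (by linarith) hh.le)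
  have hA1 : (κ + 1) * T ≤ A := Real.le_sqrt_of_sq_le hn1
  have hR1 : R ≤ (κ + 1) * T + 2 * H := by
    refine Real.sqrt_le_iff.2 ⟨by positivity, ?_⟩
    have h1 : 0 ≤ (κ + 1) * T * H := by positivity
    have h2 : ((κ + 1) * T + 2 * H) ^ 2 = ((κ + 1) * T) ^ 2 + 4 * ((κ + 1) * T * H) + 4 * h := by
      rw [← hHsq]; ring
    rw [h2, add_mul]
    linarith
  have hDT : ∀ x ∈ Icc 0 R, |x - T| + b ≤ D * T := by
    intro x hx
    have h1 : |x - T| ≤ κ * T + 2 * H + T := by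
      rw [abs_le]
      have : 0 ≤ κ * T := by positivity
      have h2 := hx.1
      have h3 := hx.2.trans hR1
      rw [add_mul, one_mul] at h3
      constructor <;> linarith
    have h2 : H ≤ H * T := le_mul_of_one_le_right hH0.le hT1
    have h3 : b ≤ b * T := le_mul_of_one_le_right hb0.le hT1
    have h4 : D * T = κ * T + T + 2 * (H * T) + b * T := by rw [hD]; ring
    linarith
  -- the left side: one of the two candidates keeps `|X|` and `|z|` apart
  obtain ⟨r, hr1, hrH, hrsep, hrM⟩ : ∃ r : ℝ, r₁ ≤ r ∧ r < H ∧
      ((1 + μ) * ‖z‖ ≤ C * Real.exp ((r - T) / α) ∨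
        (1 + μ) * (C * Real.exp ((r - T) / α)) ≤ ‖z‖) ∧
      ∀ y : ℝ, (y ∈ Icc 0 b → ‖kernel h (r + y * I)‖ ≤ M) ∧
        (y ∈ Icc (-b) 0 → ‖kernel h (r + y * I) - 1‖ ≤ M) := by
    by_cases hcase : (1 + μ) * (C * Real.exp ((r₁ - T) / α)) ≤ ‖z‖
    · refine ⟨r₁, le_rfl, hr₁₂.trans hr₂H, Or.inr hcase, fun y => ?_⟩
      have h1 := hM₁ r₁ le_rfl ⟨0, by rw [hr₁sq]; push_cast; ring⟩ y
      exact ⟨fun hy => (h1.1 hy).trans (by linarith), fun hy => (h1.2 hy).trans (by linarith)⟩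
    · refine ⟨r₂, hr₁₂.le, hr₂H, Or.inl ?_, fun y => ?_⟩
      · have h1 : C * Real.exp ((r₂ - T) / α) =
            (1 + μ) * ((1 + μ) * (C * Real.exp ((r₁ - T) / α))) := by
          rw [← mul_assoc, hμ2, mul_left_comm, ← Real.exp_add]
          congr 2
          ring
        rw [h1]
        exact mul_le_mul_of_nonneg_left (not_le.1 hcase).le (by linarith)
      · have h1 := hM₂ r₂ hr₁₂.le ⟨0, by rw [hr₂sq]; push_cast; ring⟩ y
        exact ⟨fun hy => (h1.1 hy).trans (by linarith), fun hy => (h1.2 hy).trans (by linarith)⟩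
  have hr0 : 0 < r := hr₁0.trans_le hr1
  have hrT : r ≤ T := hrH.le.trans hTH
  have hrA : r ≤ A := hrT.trans ((le_mul_of_one_le_left hT0.le (by linarith)).trans hA1)
  have hrR : r ≤ R := hrA.trans hAR
  have hcμ : ∀ X y : ℂ, (1 + μ) * ‖y‖ ≤ ‖X‖ ∨ (1 + μ) * ‖X‖ ≤ ‖y‖ →
      c * (‖X‖ + ‖y‖) ≤ ‖X + y‖ := fun X y hXy => by
    refine le_trans ?_ (norm_add_ge_of_separated hμ hXy)
    exact mul_le_mul_of_nonneg_right (min_le_right _ _) (by positivity)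
  have hsnorm : ∀ k ∈ Finset.Icc 1 m, ‖(node β m k : ℂ)‖ = node β m k := fun k hk => by
    rw [Complex.norm_real, Real.norm_of_nonneg (zero_lt_one.trans (node_bounds hk).1).le]
  have hsep : ∀ x : ℝ, x = r ∨ x = R → ∀ w : ℂ, w.re = x →
      c * (‖expScale α C T w‖ + ‖z‖) ≤ ‖expScale α C T w + z‖ ∧
      ∀ k ∈ Finset.Icc 1 m, c * (‖expScale α C T w‖ + node β m k) ≤
        ‖expScale α C T w + node β m k‖ := by
    intro x hx w hw
    have hX : ‖expScale α C T w‖ = C * Real.exp ((x - T) / α) := by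
      rw [norm_expScale hC, hw]
    rcases hx with rfl | rfl
    · refine ⟨hcμ _ _ (by rw [hX]; exact hrsep), fun k hk => ?_⟩
      have h1 := hcμ (expScale α C T w) (node β m k) (Or.inr (by
        rw [hX, hsnorm k hk]
        refine le_trans ?_ (hTa.trans (node_bounds hk).1.le)
        gcongr))
      rwa [hsnorm k hk] at h1
    · have hbig : (1 + μ) * 5 ≤ ‖expScale α C T w‖ := by
        rw [hX]
        refine hTb.trans ?_
        gcongr
        linarith
      refine ⟨hcμ _ _ (Or.inl (le_trans ?_ hbig)), fun k hk => ?_⟩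
      · gcongr; linarith
      · have h1 := hcμ (expScale α C T w) (node β m k) (Or.inl (by
          rw [hsnorm k hk]
          refine le_trans ?_ hbig
          gcongr
          exact (node_bounds hk).2))
        rwa [hsnorm k hk] at h1
  have hM : ∀ x : ℝ, x = r ∨ x = R → ∀ y : ℝ,
      (y ∈ Icc 0 b → ‖kernel h (x + y * I)‖ ≤ M) ∧
      (y ∈ Icc (-b) 0 → ‖kernel h (x + y * I) - 1‖ ≤ M) := by
    rintro x (rfl | rfl) y
    · exact hrM y
    · have h1 := hM₃ R (hr1.trans hrR) ⟨n, by rw [hRsq]; push_cast; ring⟩ y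
      exact ⟨fun hy => (h1.1 hy).trans (by linarith), fun hy => (h1.2 hy).trans (by linarith)⟩
  set S := S₀ * (T ^ l * Real.exp (-T)) with hS
  -- the common bound near both ends
  have hends : ∀ x y : ℝ, |y| ≤ b → (x ∈ Icc 0 r ∨ x ∈ Icc A R) →
      (c * (‖expScale α C T (x + y * I)‖ + ‖z‖) ≤ ‖expScale α C T (x + y * I) + z‖ ∧
      ∀ k ∈ Finset.Icc 1 m, c * (‖expScale α C T (x + y * I)‖ + node β m k) ≤
        ‖expScale α C T (x + y * I) + node β m k‖) → ‖G (x + y * I)‖ ≤ S := by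
    intro x y hy hx hXY
    have h1 := norm_integrandSqrt_le (l := l) hC hκ' hc hz (fun k hk => node_bounds hk)
      hXY.1 hXY.2
    have hre : (x + y * I : ℂ).re = x := by simp
    rw [hre] at h1
    have hx0 : x ∈ Icc 0 R := by
      rcases hx with hx | hx
      · exact ⟨hx.1, hx.2.trans hrR⟩
      · exact ⟨hA0.trans hx.1, hx.2⟩
    have h2 : ‖(x + y * I : ℂ) - T‖ ≤ D * T := by
      refine (Complex.norm_le_abs_re_add_abs_im _).trans (le_trans ?_ (hDT x hx0))
      simpa using hy
    have h3 : min (Real.exp (x - T)) (Real.exp (-((x - T) / κ))) ≤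
        Real.exp H * Real.exp (-T) := by
      rw [← Real.exp_add]
      rcases hx with hx | hx
      · exact (min_le_left _ _).trans (Real.exp_le_exp.2 (by linarith [hx.2]))
      · refine (min_le_right _ _).trans (Real.exp_le_exp.2 ?_)
        have h4 : T ≤ (x - T) / κ := by
          rw [le_div_iff₀ hκ]; linarith [hx.1]
        linarith
    calc ‖G (x + y * I)‖ ≤ M1 * ((D * T) ^ l * (Real.exp H * Real.exp (-T))) := by
          refine h1.trans ?_
          gcongr
      _ = S := by rw [hS, hS₀, mul_pow]; ring
  have hSside : ∀ x : ℝ, x = r ∨ x = R → ∀ y ∈ Icc (-b) b, ‖G (x + y * I)‖ ≤ S := by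
    intro x hx y hy
    refine hends x y (abs_le.2 hy) ?_ (hsep x hx _ (by simp))
    rcases hx with rfl | rfl
    · exact Or.inl ⟨hr0.le, le_rfl⟩
    · exact Or.inr ⟨hAR, le_rfl⟩
  have hSreal : ∀ x : ℝ, (x ∈ Icc 0 r ∨ x ∈ Icc A R) → ‖G x‖ ≤ S := by
    intro x hx
    have hq : 0 ≤ C * Real.exp ((x - T) / α) := by positivity
    have key : ∀ y : ℂ, |y.arg| ≤ θ →
        c * (‖expScale α C T x‖ + ‖y‖) ≤ ‖expScale α C T x + y‖ := fun y hy => by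
      rw [expScale_ofReal, Complex.norm_real, Real.norm_of_nonneg hq]
      refine le_trans ?_ (norm_ofReal_add_ge hq hθ.le hy)
      exact mul_le_mul_of_nonneg_right (min_le_left _ _) (by positivity)
    have h1 := hends x 0 (by simpa using hb0.le) hx
    rw [ofReal_zero, zero_mul, add_zero] at h1
    refine h1 ⟨key z hza, fun k hk => ?_⟩
    have h2 := key (node β m k) (by
      rw [Complex.arg_ofReal_of_nonneg (zero_lt_one.trans (node_bounds hk).1).le, abs_zero]
      exact hθ0)
    rwa [hsnorm k hk] at h2
  have heta := eta_sq hα hβ₂ hσ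
  rw [← hhdef, ← hθdef] at heta
  have hmain := norm_quadrature_error_le (ρ := r₁) (T := T) (l := l) (B := B) (J := J) hα hC hθ0
    hθ hz0 hz hza hκ' (fun k hk => node_bounds (β := β) hk) hd hd1 hsd hh hr₁0 hr1
    (hHsq ▸ pow_lt_pow_left₀ hrH hr0.le two_ne_zero) hrR hRsq hc (min_le_left _ _) hsep hM hSside hB0
    (by rw [heta]; exact hB) (by rw [heta]; exact hJ r R hr0 hrR)
  -- the parts of the integral that the contour does not cover
  have hcont : Continuous fun x : ℝ => G x :=
    continuous_integrandSqrt_ofReal hC hθ0 hθ hza fun k hk => node_bounds hk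
  have hsplit : (∫ x in (0 : ℝ)..A, G x) =
      (∫ x in (0 : ℝ)..r, G x) + (∫ x in r..R, G x) - ∫ x in A..R, G x := by
    have e1 := intervalIntegral.integral_add_adjacent_intervals
      (hcont.intervalIntegrable 0 r) (hcont.intervalIntegrable (μ := volume) r R)
    have e2 := intervalIntegral.integral_add_adjacent_intervals
      (hcont.intervalIntegrable 0 A) (hcont.intervalIntegrable (μ := volume) A R)
    rw [e1, ← e2]; ring
  have hS0 : 0 ≤ S := by positivity
  have hi1 : ‖∫ x in (0 : ℝ)..r, G x‖ ≤ S * H := by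
    have := intervalIntegral.norm_integral_le_of_norm_le_const (a := 0) (b := r)
      (f := fun x : ℝ => G x) (C := S) (fun x hx => by
        rw [uIoc_of_le hr0.le] at hx
        exact hSreal x (Or.inl ⟨hx.1.le, hx.2⟩))
    rw [sub_zero, abs_of_pos hr0] at this
    exact this.trans (mul_le_mul_of_nonneg_left hrH.le hS0)
  have hi2 : ‖∫ x in A..R, G x‖ ≤ S * (2 * H) := by
    have := intervalIntegral.norm_integral_le_of_norm_le_const (a := A) (b := R)
      (f := fun x : ℝ => G x) (C := S) (fun x hx => by
        rw [uIoc_of_le hAR] at hx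
        exact hSreal x (Or.inr ⟨hx.1.le, hx.2⟩))
    rw [abs_of_nonneg (sub_nonneg.2 hAR)] at this
    exact this.trans (mul_le_mul_of_nonneg_left (by linarith) hS0)
  set Q := ∑ j ∈ Finset.Icc 1 n, h / (2 * (Real.sqrt (j * h) : ℂ)) * G (Real.sqrt (j * h))
    with hQ
  have htot : ‖(∫ x in (0 : ℝ)..A, G x) - Q‖ ≤
      ‖∫ x in (0 : ℝ)..r, G x‖ + ‖(∫ x in r..R, G x) - Q‖ + ‖∫ x in A..R, G x‖ := by
    rw [hsplit, show (∫ x in (0 : ℝ)..r, G x) + (∫ x in r..R, G x) - (∫ x in A..R, G x) - Q =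
      (∫ x in (0 : ℝ)..r, G x) + ((∫ x in r..R, G x) - Q) - ∫ x in A..R, G x by ring]
    exact (norm_sub_le _ _).trans (add_le_add (norm_add_le _ _) le_rfl)
  have hfin : ‖(∫ x in (0 : ℝ)..A, G x) - Q‖ ≤
      KB * B + KJ * J + KS * (T ^ l * Real.exp (-T)) := by
    refine htot.trans ((add_le_add (add_le_add hi1 hmain) hi2).trans (le_of_eq ?_))
    simp only [hKB, hKJ, hKS, hS]
    ring
  refine hfin.trans ?_
  have hTl : 0 ≤ T ^ l * Real.exp (-T) := by positivity
  rw [show (KB + KJ + KS) * (T ^ l * Real.exp (-T) + B + J) =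
    KB * B + KJ * J + KS * (T ^ l * Real.exp (-T)) + (KB * (T ^ l * Real.exp (-T)) + KB * J +
      KJ * (T ^ l * Real.exp (-T)) + KJ * B + KS * B + KS * J) by ring]
  exact le_add_of_nonneg_right (by positivity)

/-! ### Bounds for residues and horizontal sides, and the two regimes -/

lemma pow_le_const_mul_exp {ε v : ℝ} (hε : 0 < ε) (hv : 0 ≤ v) (l : ℕ) :
    v ^ l ≤ (l.factorial / ε ^ l) * Real.exp (ε * v) := by
  have h1 := Real.pow_div_factorial_le_exp (ε * v) (by positivity) l
  rw [div_le_iff₀ (by positivity), mul_pow] at h1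
  rw [div_mul_eq_mul_div, le_div_iff₀ (by positivity)]
  linarith

lemma exists_integral_exp_neg_abs_le {a : ℝ} (ha : 0 < a) :
    ∃ K : ℝ, 0 < K ∧ ∀ t r R : ℝ, r ≤ R → ∫ x in r..R, Real.exp (-(a * |x - t|)) ≤ K := by
  have hint : Integrable fun x : ℝ => Real.exp (-(a * |x|)) := by
    rw [← integrableOn_univ, ← Iic_union_Ioi (a := (0 : ℝ)), integrableOn_union]
    constructor
    · refine (integrableOn_exp_mul_Iic ha 0).congr_fun (fun x hx => ?_) measurableSet_Iic
      rw [abs_of_nonpos hx]; simp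
    · refine (integrableOn_exp_mul_Ioi (neg_neg_of_pos ha) 0).congr_fun (fun x hx => ?_)
        measurableSet_Ioi
      rw [abs_of_pos hx]; simp
  have h0 : 0 ≤ ∫ x : ℝ, Real.exp (-(a * |x|)) := integral_nonneg fun x => (Real.exp_pos _).le
  refine ⟨(∫ x : ℝ, Real.exp (-(a * |x|))) + 1, by linarith, fun t r R hrR => ?_⟩
  rw [intervalIntegral.integral_comp_sub_right (fun x => Real.exp (-(a * |x|))) t,
    intervalIntegral.integral_of_le (by linarith)]
  have := setIntegral_le_integral (s := Ioc (r - t) (R - t)) hint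
    (Eventually.of_forall fun x => (Real.exp_pos _).le)
  linarith

/-- For `ω ≥ 1` the residues are largest at the poles with real part near `0`. -/
lemma residue_bound_of_one_le {ω b τm T τ : ℝ} (hω : 1 ≤ ω) (hb : 0 < b) (hT : 1 ≤ T) (l : ℕ)
    (h1 : -T < τ) (h2 : τ ≤ τm) :
    (|τ| + b) ^ l * Real.exp (τ - ω * (τ + T)) ≤
      (1 + |τm| + b) ^ l * (T ^ l * Real.exp (-T)) := by
  have h3 : |τ| + b ≤ (1 + |τm| + b) * T := by
    have h4 : |τ| ≤ T + |τm| := by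
      rw [abs_le]
      have := le_abs_self τm
      have := abs_nonneg τm
      constructor <;> linarith
    have h5 : |τm| ≤ |τm| * T := le_mul_of_one_le_right (abs_nonneg _) hT
    have h6 : b ≤ b * T := le_mul_of_one_le_right hb.le hT
    rw [add_mul, add_mul, one_mul]
    linarith
  rw [← mul_assoc, ← mul_pow]
  have h7 : τ - ω * (τ + T) ≤ -T := by nlinarith
  gcongr

/-- For `ω < 1` the residues are largest at the poles with real part near `T`. -/
lemma exists_residue_bound_of_lt_one {ω b : ℝ} (hω1 : ω < 1) (hb : 0 < b)
    (τm : ℝ) (l : ℕ) :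
    ∃ K : ℝ, 0 < K ∧ ∀ T τ : ℝ, τ ≤ τm →
      (|τ| + b) ^ l * Real.exp (τ - ω * (τ + T)) ≤ K * Real.exp (-(ω * T)) := by
  have hε : 0 < 1 - ω := by linarith
  refine ⟨l.factorial / (1 - ω) ^ l * Real.exp ((1 - ω) * (2 * |τm| + b)), by positivity,
    fun T τ hτ => ?_⟩
  have h1 := pow_le_const_mul_exp hε (by positivity : 0 ≤ |τ| + b) l
  have h2 : (1 - ω) * (|τ| + b) + (τ - ω * (τ + T)) ≤
      (1 - ω) * (2 * |τm| + b) + -(ω * T) := by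
    have h3 : |τ| + τ ≤ 2 * |τm| := by
      have := le_abs_self τm
      rcases abs_cases τ with ⟨h, -⟩ | ⟨h, -⟩ <;> rw [h]
      · linarith
      · linarith [abs_nonneg τm]
    nlinarith [mul_le_mul_of_nonneg_left h3 hε.le]
  calc _ ≤ l.factorial / (1 - ω) ^ l * Real.exp ((1 - ω) * (|τ| + b)) *
        Real.exp (τ - ω * (τ + T)) := by gcongr
    _ = l.factorial / (1 - ω) ^ l * Real.exp ((1 - ω) * (|τ| + b) + (τ - ω * (τ + T))) := by
        rw [mul_assoc, ← Real.exp_add]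
    _ ≤ l.factorial / (1 - ω) ^ l *
        Real.exp ((1 - ω) * (2 * |τm| + b) + -(ω * T)) := by gcongr
    _ = _ := by rw [Real.exp_add]; ring

/-- Integrals over the horizontal sides, `ω = η² ≥ 1`. The height `2 π α` is at least twice the least
height of a pole, whence the rate `2 ω`. -/
lemma exists_horizontal_bound_of_one_le {ω b κ : ℝ} (hω : 1 ≤ ω) (hb : 0 < b) (l : ℕ) :
    ∃ K : ℝ, 0 < K ∧ ∀ T r R : ℝ, 1 ≤ T → 0 < r → r ≤ R →
      ∫ x in r..R, (|x - T| + b) ^ l * min (Real.exp (x - T)) (Real.exp (-((x - T) / κ))) *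
        Real.exp (-(2 * ω * x)) ≤ K * (T ^ l * Real.exp (-T)) := by
  obtain ⟨K₀, hK₀, hK⟩ := exists_integral_exp_neg_abs_le (a := 1 / 2) (by norm_num)
  set k : ℝ := l.factorial / (1 / 2) ^ l * Real.exp (1 / 2 * (1 + b)) with hk
  have hk0 : 0 < k := by positivity
  refine ⟨k * K₀, by positivity, fun T r R hT hr hrR => ?_⟩
  have hpt : ∀ x ∈ Icc r R, (|x - T| + b) ^ l *
      min (Real.exp (x - T)) (Real.exp (-((x - T) / κ))) * Real.exp (-(2 * ω * x)) ≤
      T ^ l * Real.exp (-T) * k * Real.exp (-(1 / 2 * |x - 0|)) := by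
    intro x hx
    have hx0 : 0 < x := hr.trans_le hx.1
    rw [sub_zero, abs_of_pos hx0]
    have h1 : |x - T| + b ≤ T * (1 + b + x) := by
      have h2 : |x - T| ≤ x + T := by rw [abs_le]; constructor <;> linarith
      have h3 : x ≤ T * x := le_mul_of_one_le_left hx0.le hT
      have h4 : b ≤ T * b := le_mul_of_one_le_left hb.le hT
      rw [mul_add, mul_add, mul_one]
      linarith
    have h2 := pow_le_const_mul_exp (by norm_num : (0 : ℝ) < 1 / 2)
      (by positivity : 0 ≤ 1 + b + x) l
    have h3 : Real.exp (-(2 * ω * x)) ≤ Real.exp (-(2 * x)) :=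
      Real.exp_le_exp.2 (by nlinarith)
    calc _ ≤ (T * (1 + b + x)) ^ l * Real.exp (x - T) * Real.exp (-(2 * x)) := by
          gcongr
          exact min_le_left _ _
      _ = T ^ l * (1 + b + x) ^ l * Real.exp (-T - x) := by
          rw [mul_pow, mul_assoc, ← Real.exp_add]; congr 2; ring
      _ ≤ T ^ l * (l.factorial / (1 / 2) ^ l * Real.exp (1 / 2 * (1 + b + x))) *
          Real.exp (-T - x) := by gcongr
      _ = _ := by
          rw [hk, show Real.exp (-T - x) = Real.exp (-T) * Real.exp (-(1 / 2 * x)) *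
              Real.exp (-(1 / 2 * x)) by rw [← Real.exp_add, ← Real.exp_add]; congr 1; ring,
            show 1 / 2 * (1 + b + x) = 1 / 2 * (1 + b) + 1 / 2 * x by ring, Real.exp_add,
            Real.exp_neg (1 / 2 * x)]
          field_simp
  calc _ ≤ ∫ x in r..R, T ^ l * Real.exp (-T) * k * Real.exp (-(1 / 2 * |x - 0|)) := by
        refine intervalIntegral.integral_mono_on hrR ?_ ?_ hpt
        · exact Continuous.intervalIntegrable (by fun_prop) _ _
        · exact Continuous.intervalIntegrable (by fun_prop) _ _
    _ = T ^ l * Real.exp (-T) * k * ∫ x in r..R, Real.exp (-(1 / 2 * |x - 0|)) :=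
        intervalIntegral.integral_const_mul _ _
    _ ≤ T ^ l * Real.exp (-T) * k * K₀ := by
        have := hK 0 r R hrR
        gcongr
    _ = _ := by ring

/-- Integrals over the horizontal sides, `ω = η² < 1`. One half of the rate `2 ω` is spent on
`exp (-ω T)`, and what is left decays in both directions away from `x = T`. -/
lemma exists_horizontal_bound_of_lt_one {ω b κ : ℝ} (hω0 : 0 < ω) (hω1 : ω < 1) (hb : 0 < b)
    (hκ : 0 < κ) (l : ℕ) :
    ∃ K : ℝ, 0 < K ∧ ∀ T r R : ℝ, 0 < r → r ≤ R →
      ∫ x in r..R, (|x - T| + b) ^ l * min (Real.exp (x - T)) (Real.exp (-((x - T) / κ))) *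
        Real.exp (-(2 * ω * x)) ≤ K * Real.exp (-(ω * T)) := by
  set δ : ℝ := min ω (1 - ω) with hδ
  have hδ0 : 0 < δ := lt_min hω0 (by linarith)
  obtain ⟨K₀, hK₀, hK⟩ := exists_integral_exp_neg_abs_le (half_pos hδ0)
  set k : ℝ := l.factorial / (δ / 2) ^ l * Real.exp (δ / 2 * b) with hk
  have hk0 : 0 < k := by positivity
  refine ⟨k * K₀, by positivity, fun T r R hr hrR => ?_⟩
  have hpt : ∀ x ∈ Icc r R, (|x - T| + b) ^ l *
      min (Real.exp (x - T)) (Real.exp (-((x - T) / κ))) * Real.exp (-(2 * ω * x)) ≤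
      Real.exp (-(ω * T)) * k * Real.exp (-(δ / 2 * |x - T|)) := by
    intro x hx
    have hx0 : 0 < x := hr.trans_le hx.1
    have h2 := pow_le_const_mul_exp (half_pos hδ0) (by positivity : 0 ≤ |x - T| + b) l
    have h3 : min (Real.exp (x - T)) (Real.exp (-((x - T) / κ))) * Real.exp (-(2 * ω * x)) ≤
        Real.exp (-(ω * T)) * Real.exp (-(δ * |x - T|)) := by
      have h4 : Real.exp (-(2 * ω * x)) ≤ Real.exp (-(ω * x)) :=
        Real.exp_le_exp.2 (by nlinarith [mul_pos hω0 hx0])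
      rcases le_total x T with hxT | hxT
      · have h5 : δ ≤ 1 - ω := min_le_right _ _
        calc _ ≤ Real.exp (x - T) * Real.exp (-(ω * x)) := by
              gcongr
              exact min_le_left _ _
          _ ≤ _ := by
              rw [← Real.exp_add, ← Real.exp_add, Real.exp_le_exp,
                abs_of_nonpos (by linarith)]
              nlinarith [mul_le_mul_of_nonneg_right h5 (sub_nonneg.2 hxT)]
      · have h5 : δ ≤ ω := min_le_left _ _
        have h6 : Real.exp (-((x - T) / κ)) ≤ 1 := by
          rw [Real.exp_le_one_iff, neg_nonpos]
          exact div_nonneg (by linarith) hκ.le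
        calc _ ≤ 1 * Real.exp (-(ω * x)) := by
              gcongr
              exact (min_le_right _ _).trans h6
          _ ≤ _ := by
              rw [one_mul, ← Real.exp_add, Real.exp_le_exp, abs_of_nonneg (by linarith)]
              nlinarith [mul_le_mul_of_nonneg_right h5 (sub_nonneg.2 hxT)]
    calc _ = (|x - T| + b) ^ l * (min (Real.exp (x - T)) (Real.exp (-((x - T) / κ))) *
          Real.exp (-(2 * ω * x))) := by ring
      _ ≤ (l.factorial / (δ / 2) ^ l * Real.exp (δ / 2 * (|x - T| + b))) *
          (Real.exp (-(ω * T)) * Real.exp (-(δ * |x - T|))) := by gcongr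
      _ = _ := by
          rw [hk, show δ / 2 * (|x - T| + b) = δ / 2 * b + δ / 2 * |x - T| by ring,
            Real.exp_add, show -(δ * |x - T|) = -(δ / 2 * |x - T|) + -(δ / 2 * |x - T|) by ring,
            Real.exp_add, Real.exp_neg (δ / 2 * |x - T|)]
          field_simp
  calc _ ≤ ∫ x in r..R, Real.exp (-(ω * T)) * k * Real.exp (-(δ / 2 * |x - T|)) := by
        refine intervalIntegral.integral_mono_on hrR ?_ ?_ hpt
        · exact Continuous.intervalIntegrable (by fun_prop) _ _
        · exact Continuous.intervalIntegrable (by fun_prop) _ _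
    _ = Real.exp (-(ω * T)) * k * ∫ x in r..R, Real.exp (-(δ / 2 * |x - T|)) :=
        intervalIntegral.integral_const_mul _ _
    _ ≤ Real.exp (-(ω * T)) * k * K₀ := by
        have := hK T r R hrR
        gcongr
    _ = _ := by ring

/-- For each fixed number of points the error is bounded uniformly on the sector. -/
lemma exists_quadError_le {α β σ C : ℝ} {m : ℕ} (l : ℕ) (hα : 0 < α) (hβ₀ : 0 ≤ β)
    (hβ₂ : β < 2) (hσ : 0 < σ) (hC : 0 < C) (N : ℕ) :
    ∃ K : ℝ, ∀ z ∈ sector β, ‖quadError α β σ C m l N z‖ ≤ K := by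
  have hpi := Real.pi_pos
  have hθ0 : 0 ≤ β * Real.pi / 2 := by positivity
  have hθ : β * Real.pi / 2 < Real.pi := by nlinarith
  have hc := sectorConst_pos hθ0 hθ
  set c := sectorConst (β * Real.pi / 2) with hcdef
  set T := trunc α σ N with hT
  set κ := kappa α m with hκ
  set g : ℝ → ℝ := fun x => C ^ α * (1 / c) * (6 / c) ^ m * max 1 ((C ^ (m + 1))⁻¹) *
    (‖(x : ℂ) - T‖ ^ l * min (Real.exp (x - T)) (Real.exp (-((x - T) / κ)))) with hg
  have hgc : Continuous g := by simp only [hg]; fun_prop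
  refine ⟨(∫ x in (0 : ℝ)..Real.sqrt (numPoints α m N * step α σ), g x) +
    ∑ j ∈ Finset.Icc 1 (numPoints α m N),
      ‖(step α σ / (2 * (Real.sqrt (j * step α σ) : ℂ)) : ℂ)‖ * g (Real.sqrt (j * step α σ)),
    fun z hzs => ?_⟩
  obtain ⟨hz, hza⟩ := sector_spec hβ₂ hzs
  have hG : ∀ x : ℝ, ‖integrandSqrt α C T (node β m) m l z x‖ ≤ g x := by
    intro x
    have hq : 0 ≤ C * Real.exp ((x - T) / α) := by positivity
    have key : ∀ y : ℂ, |y.arg| ≤ β * Real.pi / 2 →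
        c * (‖expScale α C T x‖ + ‖y‖) ≤ ‖expScale α C T x + y‖ := fun y hy => by
      rw [expScale_ofReal, Complex.norm_real, Real.norm_of_nonneg hq]
      exact norm_ofReal_add_ge hq hθ.le hy
    have h1 := norm_integrandSqrt_le (l := l) hC (one_div_kappa (m := m) hα) hc hz
      (fun k hk => node_bounds (β := β) hk) (key z hza) (fun k hk => by
        have hs0 : 0 ≤ node β m k := (zero_lt_one.trans (node_bounds hk).1).le
        have h2 := key (node β m k) (by
          rw [Complex.arg_ofReal_of_nonneg hs0, abs_zero]; exact hθ0)
        rwa [Complex.norm_real, Real.norm_of_nonneg hs0] at h2)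
    rw [ofReal_re] at h1
    exact h1
  rw [quadError_eq hα hβ₀ hβ₂ hσ hC hzs]
  refine (norm_sub_le _ _).trans (add_le_add ?_ ?_)
  · exact intervalIntegral.norm_integral_le_of_norm_le (Real.sqrt_nonneg _)
      (Eventually.of_forall fun x _ => hG x) (hgc.intervalIntegrable _ _)
  · refine norm_sum_le_of_le _ fun j _ => ?_
    rw [norm_mul]
    exact mul_le_mul_of_nonneg_left (hG _) (norm_nonneg _)

/-- A bound for all large `N` extends to all `N ≥ 1` at the cost of a larger constant. -/
lemma exists_uniform_bound {ι : Type*} {S : Set ι} {E : ℕ → ι → ℝ} {B : ℕ → ℝ}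
    (hB : ∀ N, 1 ≤ N → 0 < B N) (hE : ∀ N, ∃ K, ∀ z ∈ S, E N z ≤ K)
    (h : ∃ K N₀, ∀ N, N₀ ≤ N → ∀ z ∈ S, E N z ≤ K * B N) :
    ∃ K : ℝ, 0 < K ∧ ∀ N, 1 ≤ N → ∀ z ∈ S, E N z ≤ K * B N := by
  choose k hk using hE
  obtain ⟨K, N₀, hK⟩ := h
  have hsum : 0 ≤ ∑ n ∈ Finset.range N₀, |k n| / |B n| :=
    Finset.sum_nonneg fun n _ => by positivity
  refine ⟨|K| + 1 + ∑ n ∈ Finset.range N₀, |k n| / |B n|, by positivity, fun N hN z hz => ?_⟩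
  have hBN := hB N hN
  rcases le_or_gt N₀ N with h1 | h1
  · refine (hK N h1 z hz).trans (mul_le_mul_of_nonneg_right ?_ hBN.le)
    linarith [le_abs_self K]
  · have h2 : |k N| / |B N| ≤ ∑ n ∈ Finset.range N₀, |k n| / |B n| :=
      Finset.single_le_sum (f := fun n => |k n| / |B n|) (fun n _ => by positivity)
        (Finset.mem_range.2 h1)
    rw [abs_of_pos hBN] at h2
    refine (hk N z hz).trans ((le_abs_self _).trans ?_)
    rw [← div_le_iff₀ hBN]
    linarith [abs_nonneg K]

lemma eventually_le_trunc {α σ : ℝ} (hα : 0 < α) (hσ : 0 < σ) (T₀ : ℝ) :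
    ∃ N₀ : ℕ, ∀ N, N₀ ≤ N → T₀ ≤ trunc α σ N := by
  have h1 : Tendsto (fun N : ℕ => trunc α σ N) atTop atTop :=
    (Real.tendsto_sqrt_atTop.comp tendsto_natCast_atTop_atTop).const_mul_atTop (mul_pos hσ hα)
  exact eventually_atTop.1 (h1.eventually_ge_atTop T₀)

lemma sigmaOpt_pos {α β : ℝ} (hα : 0 < α) (hβ₂ : β < 2) : 0 < sigmaOpt α β := by
  have h1 : 0 < Real.sqrt (2 * (2 - β)) := Real.sqrt_pos.2 (by linarith)
  have h2 : 0 < Real.sqrt α := Real.sqrt_pos.2 hα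
  have := Real.pi_pos
  unfold sigmaOpt
  positivity

/-- Both exponents of the final estimate are expressed through `η T`. -/
lemma rate_eq {α β σ : ℝ} (hα : 0 < α) (hβ₂ : β < 2) (hσ : 0 < σ) (N : ℕ) :
    Real.pi * Real.sqrt (2 * (2 - β) * (N : ℝ) * α) = eta α β σ * trunc α σ N := by
  have h2 : 0 < Real.sqrt α := Real.sqrt_pos.2 hα
  rw [eta, sigmaOpt, trunc, Real.sqrt_mul (by have : 0 ≤ 2 - β := by linarith
                                              positivity),
    Real.sqrt_mul (by linarith)]
  field_simp
  rw [Real.sq_sqrt hα.le]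

/-- If `η ≥ 1`, the truncation error dominates. -/
theorem exists_quadError_le_of_le_sigmaOpt {α β σ C : ℝ} {m l : ℕ} (hα : 0 < α) (hβ₀ : 0 ≤ β)
    (hβ₂ : β < 2) (hσ : 0 < σ) (hC : 0 < C) (hm : α < m + 1) (hopt : σ ≤ sigmaOpt α β) :
    ∃ K : ℝ, 0 < K ∧ ∀ N : ℕ, 1 ≤ N → ∀ z ∈ sector β,
      ‖quadError α β σ C m l N z‖ ≤ K * (trunc α σ N ^ l * Real.exp (-trunc α σ N)) := by
  have hω : 1 ≤ eta α β σ ^ 2 := one_le_pow₀ ((one_le_div hσ).2 hopt)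
  have hb : 0 < 2 * Real.pi * α := by have := Real.pi_pos; positivity
  obtain ⟨K, T₀, hK0, hT₀, hK⟩ := exists_norm_quadError_le (l := l) hα hβ₀ hβ₂ hσ hC hm
  obtain ⟨KJ, hKJ0, hKJ⟩ := exists_horizontal_bound_of_one_le (κ := kappa α m) hω hb l
  obtain ⟨N₀, hN₀⟩ := eventually_le_trunc hα hσ T₀
  refine exists_uniform_bound (E := fun N z => ‖quadError α β σ C m l N z‖) (fun N hN => ?_)
    (exists_quadError_le l hα hβ₀ hβ₂ hσ hC)
    ⟨K * (1 + (1 + |α * Real.log (5 / C)| + 2 * Real.pi * α) ^ l + KJ), N₀,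
      fun N hN z hz => ?_⟩
  · have : (0 : ℝ) < N := by exact_mod_cast hN
    unfold trunc
    positivity
  · have hT := hT₀.trans (hN₀ N hN)
    have hT0 : 0 ≤ trunc α σ N := zero_le_one.trans hT
    refine (hK N (hN₀ N hN) z hz _ _ (by positivity)
      (fun τ h1 h2 => residue_bound_of_one_le hω hb hT l h1 h2)
      (fun r R hr hrR => hKJ _ r R hT hr hrR)).trans (le_of_eq ?_)
    ring

/-- If `η < 1`, the discretization error dominates. -/
theorem exists_quadError_le_of_sigmaOpt_lt {α β σ C : ℝ} {m l : ℕ} (hα : 0 < α) (hβ₀ : 0 ≤ β)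
    (hβ₂ : β < 2) (hσ : 0 < σ) (hC : 0 < C) (hm : α < m + 1) (hopt : sigmaOpt α β < σ) :
    ∃ K : ℝ, 0 < K ∧ ∀ N : ℕ, 1 ≤ N → ∀ z ∈ sector β,
      ‖quadError α β σ C m l N z‖ ≤ K * Real.exp (-(eta α β σ ^ 2 * trunc α σ N)) := by
  have hη0 : 0 < eta α β σ := div_pos (sigmaOpt_pos hα hβ₂) hσ
  have hω0 : 0 < eta α β σ ^ 2 := by positivity
  have hω1 : eta α β σ ^ 2 < 1 := pow_lt_one₀ hη0.le ((div_lt_one hσ).2 hopt) two_ne_zero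
  set ω := eta α β σ ^ 2 with hω
  have hb : 0 < 2 * Real.pi * α := by have := Real.pi_pos; positivity
  obtain ⟨K, T₀, hK0, hT₀, hK⟩ := exists_norm_quadError_le (l := l) hα hβ₀ hβ₂ hσ hC hm
  obtain ⟨KJ, hKJ0, hKJ⟩ := exists_horizontal_bound_of_lt_one hω0 hω1 hb (kappa_pos hα hm) l
  obtain ⟨KB, hKB0, hKB⟩ := exists_residue_bound_of_lt_one hω1 hb (α * Real.log (5 / C)) l
  obtain ⟨N₀, hN₀⟩ := eventually_le_trunc hα hσ T₀
  refine exists_uniform_bound (E := fun N z => ‖quadError α β σ C m l N z‖)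
    (fun N hN => Real.exp_pos _) (exists_quadError_le l hα hβ₀ hβ₂ hσ hC)
    ⟨K * (l.factorial / (1 - ω) ^ l + KB + KJ), N₀, fun N hN z hz => ?_⟩
  have hT0 : 0 ≤ trunc α σ N := zero_le_one.trans (hT₀.trans (hN₀ N hN))
  set T := trunc α σ N with hT
  have h1 : T ^ l * Real.exp (-T) ≤ l.factorial / (1 - ω) ^ l * Real.exp (-(ω * T)) := by
    have h2 := pow_le_const_mul_exp (by linarith : 0 < 1 - ω) hT0 l
    calc _ ≤ l.factorial / (1 - ω) ^ l * Real.exp ((1 - ω) * T) * Real.exp (-T) := by gcongr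
      _ = _ := by rw [mul_assoc, ← Real.exp_add]; congr 2; ring
  refine (hK N (hN₀ N hN) z hz _ _ (by positivity) (fun τ _ h2 => hKB T τ h2)
    (fun r R hr hrR => hKJ T r R hr hrR)).trans ?_
  rw [mul_assoc K, add_mul, add_mul]
  gcongr

end Tapered

theorem mainTheorem6 (α β σ C : ℝ) (hα : 0 < α) (hβ₀ : 0 ≤ β) (hβ₂ : β < 2)
    (hσ : 0 < σ) (hC : 0 < C) (l m : ℕ)
    (hlm : (l = 0 ∧ m = ⌊α⌋₊) ∨ ((l = 0 ∨ l = 1) ∧ m = ⌈α⌉₊)) :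
    -- the integral in the definition of the error converges absolutely
    (∀ N₁ : ℕ, 1 ≤ N₁ → ∀ z ∈ Tapered.sector β,
      IntervalIntegrable (fun u => Tapered.integrand α β C (Tapered.trunc α σ N₁) m l u z)
        MeasureTheory.volume 0 ((Tapered.numPoints α m N₁ : ℝ) * Tapered.step α σ)) ∧
    (σ ≤ Tapered.sigmaOpt α β →
      (∃ K : ℝ, 0 < K ∧ ∀ N₁ : ℕ, 1 ≤ N₁ → ∀ z ∈ Tapered.sector β,
        ‖Tapered.quadError α β σ C m l N₁ z‖ ≤
          K * (Tapered.trunc α σ N₁ ^ l * Real.exp (-Tapered.trunc α σ N₁))) ∧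
      ∀ N₁ : ℕ, Real.exp (-Tapered.trunc α σ N₁) =
        Real.exp (-(Real.pi * (Tapered.eta α β σ)⁻¹ *
          Real.sqrt (2 * (2 - β) * (N₁ : ℝ) * α)))) ∧
    (Tapered.sigmaOpt α β < σ →
      ∃ K : ℝ, 0 < K ∧ ∀ N₁ : ℕ, 1 ≤ N₁ → ∀ z ∈ Tapered.sector β,
        ‖Tapered.quadError α β σ C m l N₁ z‖ ≤
          K * Real.exp (-(Real.pi * Tapered.eta α β σ *
            Real.sqrt (2 * (2 - β) * (N₁ : ℝ) * α)))) := by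
  have hm : α < m + 1 := by
    rcases hlm with ⟨-, rfl⟩ | ⟨-, rfl⟩
    · exact Nat.lt_floor_add_one α
    · exact (Nat.le_ceil α).trans_lt (lt_add_one _)
  have hη0 : 0 < Tapered.eta α β σ := div_pos (Tapered.sigmaOpt_pos hα hβ₂) hσ
  refine ⟨fun N₁ _ z hz => ?_, fun hopt => ⟨?_, fun N₁ => ?_⟩, fun hopt => ?_⟩
  · have hh := Tapered.step_pos hα hσ
    exact Tapered.intervalIntegrable_integrand hβ₀ hβ₂ hC hz (by positivity)
  · exact Tapered.exists_quadError_le_of_le_sigmaOpt hα hβ₀ hβ₂ hσ hC hm hopt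
  · rw [mul_right_comm, Tapered.rate_eq hα hβ₂ hσ N₁, mul_right_comm,
      mul_inv_cancel₀ hη0.ne', one_mul]
  · obtain ⟨K, hK0, hK⟩ :=
      Tapered.exists_quadError_le_of_sigmaOpt_lt (l := l) hα hβ₀ hβ₂ hσ hC hm hopt
    refine ⟨K, hK0, fun N₁ hN₁ z hz => ?_⟩
    rw [mul_right_comm, Tapered.rate_eq hα hβ₂ hσ N₁, mul_right_comm, ← sq]
    exact hK N₁ hN₁ z hz
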